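/- Let $n\ge 0$. A \emph{Greg tree} of size $n$ is a finite nonempty tree in which $n$ vertices are labeled bijectively by $1,\dots,n$ and every other vertex is unlabeled and has degree at least $3$; two Greg trees are identified if there is a graph isomorphism between them that preserves the labels (there are none for $n=0$). Let $\mathrm{unl}(T)$ be the number of unlabeled vertices of $T$. Let $\mathcal C_m$ be the set of Cayley trees of size $m$, i.e. trees with vertex set $\{1,\dots,m\}$. For $X\in\mathcal C_m$ with $m\ge n\ge 1$, let $X|_n$ be the Greg tree of size $n$ obtained from $X$ by removing all labels greater than $n$ and then repeating the following operations until a Greg tree is reached: remove an unlabeled vertex of degree $2$ and join its two pending edges into a single edge; remove an unlabeled vertex of degree $1$ together with its incident edge. Let $T(z)=\sum_{k\ge 1} k^{k-1}\frac{z^k}{k!}$ be the tree function. Then for every Greg tree $T$ of size $n$, as formal power series in $z$ over $\mathbb Q$, \[ \sum_{m\ge n}\ \sum_{\substack{X\in\mathcal C_m\\ X|_n=T}} \frac{z^{m-n}}{(m-n)!} \;=\; \frac{e^{nT(z)}}{(1-T(z))^{n-1}}\left(\frac{T(z)}{1-T(z)}\right)^{\mathrm{unl}(T)} . \] -/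

import Mathlib

/-- A representative of a Greg tree of size `n`: a finite (nonempty) tree, `n` of whose vertices
carry distinct labels (the element `i : Fin n` stands for the label `i + 1`), and whose other
vertices are unlabeled and have degree at least 3. Two representatives give the same Greg tree
when there is a graph isomorphism between them that preserves the labels.
There is none of size 0, because a finite tree has a vertex of degree at most 1. -/
structure GregTree (n : ℕ) where
  V : Type
  finite : Finite V
  graph : SimpleGraph V
  isTree : graph.IsTree
  label : Fin n ↪ V
  three_le_degree : ∀ v, v ∉ Set.range label → 3 ≤ (graph.neighborSet v).ncard

/-- The number of unlabeled vertices. -/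
noncomputable def GregTree.unl {n : ℕ} (T : GregTree n) : ℕ :=
  (Set.range T.label)ᶜ.ncard

/-- A Cayley tree of size `m`: a tree with vertex set `{1, …, m}`
(the element `i : Fin m` stands for the vertex `i + 1`). -/
def CayleyTree (m : ℕ) : Type :=
  {X : SimpleGraph (Fin m) // X.IsTree}

/-- A graph whose vertex set is a subset of `V`. -/
abbrev PartialGraph (V : Type) : Type :=
  (⊤ : SimpleGraph V).Subgraph

/-- Remove the vertex `v` from `H` and join its neighbors; it is applied when `v` has degree 2,
so that its two pending edges become a single edge. -/
def PartialGraph.smooth {V : Type} (H : PartialGraph V) (v : V) : PartialGraph V where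
  verts := H.verts \ {v}
  Adj x y := (x ≠ v ∧ y ≠ v ∧ H.Adj x y) ∨ (x ≠ y ∧ H.Adj x v ∧ H.Adj v y)
  adj_sub := by
    rintro x y (⟨-, -, h⟩ | ⟨h, -, -⟩)
    · exact H.adj_sub h
    · simpa using h
  edge_vert := by
    rintro x y (⟨h, -, h'⟩ | ⟨-, h, -⟩)
    · exact ⟨H.edge_vert h', by simpa using h⟩
    · exact ⟨H.edge_vert h, by simpa using (H.adj_sub h).ne⟩
  symm := ⟨by
    rintro x y (⟨h₁, h₂, h⟩ | ⟨h, h₁, h₂⟩)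
    · exact Or.inl ⟨h₂, h₁, h.symm⟩
    · exact Or.inr ⟨h.symm, h₂.symm, h₁.symm⟩⟩

/-- One elementary step of the pruning process; `L` is the set of labeled vertices. -/
inductive PruneStep {V : Type} (L : Set V) : PartialGraph V → PartialGraph V → Prop
  | smooth (H : PartialGraph V) (v : V) (hv : v ∈ H.verts) (hL : v ∉ L)
      (hdeg : (H.neighborSet v).ncard = 2) : PruneStep L H (H.smooth v)
  | deleteLeaf (H : PartialGraph V) (v : V) (hv : v ∈ H.verts) (hL : v ∉ L)
      (hdeg : (H.neighborSet v).ncard = 1) : PruneStep L H (H.deleteVerts {v})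

/-- `X|_n = T`, for a Cayley tree `X` of size `n + k` and a Greg tree `T` of size `n`: forget the
labels greater than `n` in `X`, then repeatedly smooth out unlabeled vertices of degree 2 and
delete unlabeled vertices of degree 1, until the result is, up to a label-preserving
isomorphism, the Greg tree `T`. -/
def CayleyTree.RestrictsTo {n k : ℕ} (X : CayleyTree (n + k)) (T : GregTree n) : Prop :=
  ∃ H : PartialGraph (Fin (n + k)),
    Relation.ReflTransGen (PruneStep (Set.range (Fin.castAdd k : Fin n → Fin (n + k))))
      (SimpleGraph.toSubgraph X.1 le_top) H ∧
    ∃ φ : T.graph ≃g H.coe, ∀ i : Fin n, (φ (T.label i) : Fin (n + k)) = Fin.castAdd k i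

/-- The tree function `T(z) = ∑_{n ≥ 1} n^(n-1) z^n / n!`, as a formal power series. -/
noncomputable def treeSeries : PowerSeries ℚ :=
  PowerSeries.mk fun n => if n = 0 then 0 else (n : ℚ) ^ (n - 1) / (n.factorial : ℚ)

/-- The generating function `∑_{m ≥ n} ∑_{X ∈ 𝒞_m, X|_n = T} z^(m-n) / (m-n)!`, where `m = n + k`. -/
noncomputable def restrictionSeries {n : ℕ} (T : GregTree n) : PowerSeries ℚ :=
  PowerSeries.mk fun k =>
    ({X : CayleyTree (n + k) | X.RestrictsTo T}.ncard : ℚ) / (k.factorial : ℚ)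

/-!
Root every tree at the label `0` and attach to each vertex its cluster, the set of labels lying on
its descendants. In a Greg tree the clusters determine the tree: a vertex is an ancestor of another
exactly if its cluster contains the other's (`IsRooted.cluster_subset_iff`), so adjacency and the
positions of the labels can be read off from the family of clusters (`IsRooted.exists_equiv`).
Smoothing an unlabeled vertex of degree `2` or deleting an unlabeled leaf does not change the family of
nonempty clusters (`IsRooted.pruneStep`). Hence `X|_n = T` holds exactly if `X` and `T` have the same
clusters on the first `n` labels (`CayleyTree.restrictsTo_iff`), and Cayley trees of size `m`
correspond to the families of `m` clusters on `m` labels (`IsGregFamily.exists_cayleyTree`). This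
turns the count into one about laminar families.

A family with `n` labels and `u` unlabeled vertices extends to one more label by labeling an
unlabeled vertex, by labeling a new vertex on an edge, by attaching a new leaf to a vertex, or by
attaching a new leaf to a new unlabeled vertex on an edge. Counting these ways
(`IsGregFamily.sum_familyTrace_eq`) shows that the generating function depends only on `n` and `u`,
and that these functions `G n u` satisfy
`G' n u = u G (n+1) (u-1) + (2n+2u-1) G (n+1) u + (n+u-1) G (n+1) (u+1)`,
with constant coefficient `1` for `u = 0` and `0` otherwise, because a Greg tree of size `n` without
unlabeled vertices is itself a Cayley tree. The claimed series satisfy the same recurrence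
(`derivative_gregSeries`), which follows from `T = z e^T`; for the explicit coefficients of `T` this
equation is a form of Abel's binomial identity (`sum_shiftPowPoly_mul_abelPoly`).
-/

/-! ### The tree function -/

open Polynomial in
/-- The Abel polynomial `x (x + k) ^ (k - 1) / k!`. -/
noncomputable def abelPoly : ℕ → ℚ[X]
  | 0 => 1
  | k + 1 => C (1 / ((k + 1).factorial : ℚ)) * (X * (X + C ((k : ℚ) + 1)) ^ k)

open Polynomial in
/-- The polynomial `(x + k) ^ k / k!`. -/
noncomputable def shiftPowPoly (k : ℕ) : ℚ[X] :=
  C (1 / (k.factorial : ℚ)) * (X + C (k : ℚ)) ^ k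

open Polynomial in
theorem derivative_abelPoly_succ (k : ℕ) :
    derivative (abelPoly (k + 1)) = (abelPoly k).comp (X + 1) := by
  cases k with
  | zero => simp [abelPoly]
  | succ k =>
    apply Polynomial.funext
    intro x
    have h : ((k + 2).factorial : ℚ) = (k + 2) * (k + 1).factorial := by
      rw [Nat.factorial_succ]; push_cast; ring
    have h0 : ((k + 1).factorial : ℚ) ≠ 0 := by positivity
    have h1 : (k : ℚ) + 2 ≠ 0 := by positivity
    simp [abelPoly, derivative_mul, derivative_pow, h]
    field_simp
    ring

open Polynomial in
theorem derivative_shiftPowPoly_succ (k : ℕ) :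
    derivative (shiftPowPoly (k + 1)) = (shiftPowPoly k).comp (X + 1) := by
  apply Polynomial.funext
  intro x
  have h : ((k + 1).factorial : ℚ) = (k + 1) * k.factorial := by
    rw [Nat.factorial_succ]; push_cast; ring
  have h0 : (k.factorial : ℚ) ≠ 0 := by positivity
  have h1 : (k : ℚ) + 1 ≠ 0 := by positivity
  simp [shiftPowPoly, derivative_pow, h]
  field_simp
  ring

open Polynomial in
theorem Polynomial.eq_of_derivative_eq_of_eval_zero {p q : ℚ[X]}
    (h : derivative p = derivative q) (h0 : p.eval 0 = q.eval 0) : p = q := by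
  have h1 : derivative (p - q) = 0 := by simp [h]
  have h2 := eq_C_of_natDegree_eq_zero (derivative_eq_zero.mp h1)
  have h3 : (p - q).coeff 0 = 0 := by
    rw [coeff_zero_eq_eval_zero]; simp [h0]
  rw [h3, C_0] at h2
  exact sub_eq_zero.mp h2

open Polynomial in
/-- A form of Abel's binomial identity. In both families of polynomials the derivative of the member
of index `k + 1` is the shift by `1` of the member of index `k`, so by induction both sides have the
same derivative; and they agree at `0`. -/
theorem sum_shiftPowPoly_mul_abelPoly (a : ℚ) (n : ℕ) :
    ∑ p ∈ Finset.HasAntidiagonal.antidiagonal n, C ((shiftPowPoly p.1).eval a) * abelPoly p.2 =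
      (shiftPowPoly n).comp (X + C a) := by
  have h0 : abelPoly 0 = 1 := rfl
  induction n with
  | zero => simp [abelPoly, shiftPowPoly]
  | succ n ih =>
    apply Polynomial.eq_of_derivative_eq_of_eval_zero
    · rw [Finset.Nat.sum_antidiagonal_succ']
      have : (shiftPowPoly n).comp (X + 1 + C a) = ((shiftPowPoly n).comp (X + C a)).comp (X + 1) := by
        rw [comp_assoc]; simp
      rw [derivative_comp, derivative_shiftPowPoly_succ, comp_assoc]
      have h2 : ((X : ℚ[X]) + 1).comp (X + C a) = X + 1 + C a := by simp; ring
      rw [h2, this, ← ih]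
      simp [h0, derivative_mul, derivative_abelPoly_succ, sum_comp]
    · rw [Finset.Nat.sum_antidiagonal_succ']
      simp [eval_finsetSum, abelPoly]

section

open PowerSeries

theorem constantCoeff_treeSeries : constantCoeff treeSeries = 0 := by
  simp [treeSeries, ← coeff_zero_eq_constantCoeff_apply]

theorem hasSubst_natCast_mul_treeSeries (n : ℕ) :
    HasSubst ((n : PowerSeries ℚ) * treeSeries) :=
  HasSubst.of_constantCoeff_zero' (by simp [constantCoeff_treeSeries])

/-- The series `∑ (k + 1) ^ (k - 1) z ^ k / k!`; it equals `e^{T(z)}` by `exp_subst_eq_pow`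
for `n = 1`. -/
noncomputable def expTreeSeries : PowerSeries ℚ :=
  mk fun k => (abelPoly k).eval 1

theorem treeSeries_eq_X_mul : treeSeries = X * expTreeSeries := by
  ext k
  rcases k with _ | k
  · simp [treeSeries]
  · rw [coeff_succ_X_mul]
    rcases k with _ | k
    · simp [treeSeries, expTreeSeries, abelPoly]
    · have h : ((k + 2).factorial : ℚ) = (k + 2) * (k + 1).factorial := by
        rw [Nat.factorial_succ]; push_cast; ring
      simp [treeSeries, expTreeSeries, abelPoly, h]
      field_simp
      ring

/-- Abel's identity, read as an identity of power series: the coefficients of `T'` and of the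
derivative of `expTreeSeries` are the values of `shiftPowPoly` at `1` and at `2`. -/
theorem derivative_expTreeSeries :
    derivative ℚ expTreeSeries = derivative ℚ treeSeries * expTreeSeries := by
  ext n
  have h := congrArg (Polynomial.eval 1) (sum_shiftPowPoly_mul_abelPoly 1 n)
  rw [coeff_mul]
  have h2 : ∀ k, coeff k (derivative ℚ treeSeries) = (shiftPowPoly k).eval 1 := by
    intro k
    have h : ((k + 1).factorial : ℚ) = (k + 1) * k.factorial := by
      rw [Nat.factorial_succ]; push_cast; ring
    simp [coeff_derivative, treeSeries, shiftPowPoly, h]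
    field_simp
    ring
  simp only [h2]
  simp only [expTreeSeries, coeff_mk]
  simp [Polynomial.eval_finsetSum] at h
  rw [h]
  have h : ((n + 1).factorial : ℚ) = (n + 1) * n.factorial := by
    rw [Nat.factorial_succ]; push_cast; ring
  simp [coeff_derivative, shiftPowPoly, abelPoly, h]
  field_simp
  ring

theorem derivative_treeSeries_mul :
    derivative ℚ treeSeries * (1 - treeSeries) = expTreeSeries := by
  have h := congrArg (derivative ℚ) treeSeries_eq_X_mul
  rw [Derivation.leibniz, derivative_expTreeSeries] at h
  simp only [smul_eq_mul, derivative_X] at h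
  linear_combination h - (derivative ℚ treeSeries) * treeSeries_eq_X_mul

theorem constantCoeff_expTreeSeries : constantCoeff expTreeSeries = 1 := by
  simp [expTreeSeries, abelPoly, ← coeff_zero_eq_constantCoeff_apply]

theorem derivative_exp_subst (n : ℕ) :
    derivative ℚ ((exp ℚ).subst ((n : PowerSeries ℚ) * treeSeries)) =
      (exp ℚ).subst ((n : PowerSeries ℚ) * treeSeries) * (n * derivative ℚ treeSeries) := by
  rw [derivative_subst (hasSubst_natCast_mul_treeSeries n), derivative_exp, Derivation.leibniz]
  simp

theorem constantCoeff_exp_subst (n : ℕ) :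
    constantCoeff ((exp ℚ).subst ((n : PowerSeries ℚ) * treeSeries) : PowerSeries ℚ) = 1 := by
  have h := hasSubst_natCast_mul_treeSeries n
  rw [← coeff_zero_eq_constantCoeff_apply, coeff_subst' h, finsum_eq_single _ 0]
  · simp
  · intro k hk
    simp [constantCoeff_treeSeries, hk]

theorem exp_subst_eq_pow (n : ℕ) :
    ((exp ℚ).subst ((n : PowerSeries ℚ) * treeSeries) : PowerSeries ℚ) = expTreeSeries ^ n := by
  have hf := derivative_exp_subst n
  have hf0 := constantCoeff_exp_subst n
  generalize ((exp ℚ).subst ((n : PowerSeries ℚ) * treeSeries) : PowerSeries ℚ) = f at hf hf0 ⊢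
  have hE : expTreeSeries * expTreeSeries⁻¹ = 1 :=
    PowerSeries.mul_inv_cancel _ (by simp [constantCoeff_expTreeSeries])
  have h1 : f * expTreeSeries⁻¹ ^ n = 1 := by
    apply derivative.ext
    · rw [Derivation.leibniz, hf, derivative_one, Derivation.leibniz_pow,
        derivative_inv', derivative_expTreeSeries]
      rcases n with _ | n
      · simp
      · simp only [smul_eq_mul, nsmul_eq_mul, Nat.add_sub_cancel]
        push_cast
        linear_combination (-(f * (n + 1) * expTreeSeries⁻¹ ^ (n + 1) * derivative ℚ treeSeries)) * hE
    · simp [hf0, constantCoeff_expTreeSeries]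
  calc f = f * expTreeSeries⁻¹ ^ n * expTreeSeries ^ n := by
        rw [mul_assoc, ← mul_pow, mul_comm _ expTreeSeries, hE, one_pow, mul_one]
    _ = expTreeSeries ^ n := by rw [h1, one_mul]

/-- The series `e^{nT} (1 - T)^{-(n-1)} (T / (1 - T))^u`. -/
noncomputable def gregSeries (n u : ℕ) : PowerSeries ℚ :=
  expTreeSeries ^ n * (1 - treeSeries)⁻¹ ^ (n - 1) * (treeSeries * (1 - treeSeries)⁻¹) ^ u

theorem constantCoeff_gregSeries (n u : ℕ) :
    constantCoeff (gregSeries n u) = if u = 0 then 1 else 0 := by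
  simp [gregSeries, constantCoeff_treeSeries, constantCoeff_expTreeSeries, zero_pow_eq]

/-- The differential recurrence of the series `gregSeries`; the coefficients on the
right count the ways of inserting one more label into a Greg tree with `n` labeled and `u` unlabeled
vertices (compare `IsGregFamily.sum_familyTrace_eq`). -/
theorem derivative_gregSeries (n u : ℕ) (hn : 1 ≤ n) :
    derivative ℚ (gregSeries n u) =
      u * gregSeries (n + 1) (u - 1) + (2 * (n + u) - 1 : ℕ) * gregSeries (n + 1) u +
        (n + u - 1 : ℕ) * gregSeries (n + 1) (u + 1) := by
  obtain ⟨n, rfl⟩ : ∃ k, n = k + 1 := ⟨n - 1, by omega⟩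
  set W := (1 - treeSeries)⁻¹ with hW
  have hinv : (1 - treeSeries) * W = 1 :=
    PowerSeries.mul_inv_cancel _ (by simp [constantCoeff_treeSeries])
  have hD : derivative ℚ treeSeries = expTreeSeries * W := by
    linear_combination W * derivative_treeSeries_mul - (derivative ℚ treeSeries) * hinv
  have hDE : derivative ℚ expTreeSeries = expTreeSeries ^ 2 * W := by
    rw [derivative_expTreeSeries, hD]; ring
  have hDW : derivative ℚ W = W ^ 3 * expTreeSeries := by
    rw [hW, derivative_inv', map_sub, derivative_one, hD]; ring
  have hTW : treeSeries * W = W - 1 := by linear_combination -hinv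
  have hDT : derivative ℚ (W - 1) = W ^ 3 * expTreeSeries := by simp [hDW]
  have e1 : 2 * (n + 1 + u) - 1 = 2 * n + 2 * u + 1 := by omega
  have e2 : n + 1 + u - 1 = n + u := by omega
  rw [e1, e2]
  simp only [gregSeries, ← hW, hTW]
  rcases u with _ | u <;> rcases n with _ | n
  · simp [hDE]
  · simp only [Derivation.leibniz, Derivation.leibniz_pow, hDE, hDW,
      smul_eq_mul, nsmul_eq_mul, Nat.add_sub_cancel]
    push_cast
    simp
    ring
  · simp only [Derivation.leibniz, Derivation.leibniz_pow, hDE, hDT,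
      smul_eq_mul, nsmul_eq_mul, Nat.add_sub_cancel]
    push_cast
    simp
    ring
  · simp only [Derivation.leibniz, Derivation.leibniz_pow, hDE, hDW, hDT,
      smul_eq_mul, nsmul_eq_mul, Nat.add_sub_cancel]
    push_cast
    ring

end

/-! ### Families of clusters -/

/-- The families of clusters of Greg trees of size `n`. Root the tree at the label `0`; the cluster
of a vertex is the set of labels on its descendants, and the family consists of the clusters of all
vertices. Being laminar encodes the tree order, `root` says that `0` labels the root, and `sep` that
distinct labels sit on distinct vertices. There is no such family for `n = 0`. -/
structure IsGregFamily (n : ℕ) (F : Finset (Finset ℕ)) : Prop where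
  nonempty : ∀ A ∈ F, A.Nonempty
  subset : ∀ A ∈ F, A ⊆ Finset.range n
  univ_mem : Finset.range n ∈ F
  laminar : ∀ A ∈ F, ∀ B ∈ F, A ⊆ B ∨ B ⊆ A ∨ Disjoint A B
  root : ∀ A ∈ F, 0 ∈ A → A = Finset.range n
  sep : ∀ i < n, ∀ j < n, i ≠ j → ∃ A ∈ F, ¬ (i ∈ A ↔ j ∈ A)

open Classical in
/-- All families of clusters of Greg trees of size `n`. -/
noncomputable def gregFamilies (n : ℕ) : Finset (Finset (Finset ℕ)) :=
  (Finset.range n).powerset.powerset.filter (IsGregFamily n)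

theorem mem_gregFamilies {n : ℕ} {F : Finset (Finset ℕ)} :
    F ∈ gregFamilies n ↔ IsGregFamily n F := by
  simp only [gregFamilies, Finset.mem_filter, Finset.mem_powerset, and_iff_right_iff_imp]
  intro h A hA
  exact Finset.mem_powerset.mpr (h.subset A hA)

/-- The family induced on the labels smaller than `n`. -/
def familyTrace (n : ℕ) (F : Finset (Finset ℕ)) : Finset (Finset ℕ) :=
  (F.image (· ∩ Finset.range n)).erase ∅

theorem mem_familyTrace {n : ℕ} {F : Finset (Finset ℕ)} {A : Finset ℕ} :
    A ∈ familyTrace n F ↔ A.Nonempty ∧ ∃ B ∈ F, B ∩ Finset.range n = A := by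
  simp [familyTrace, Finset.nonempty_iff_ne_empty]

theorem familyTrace_familyTrace {n m : ℕ} (h : n ≤ m) (F : Finset (Finset ℕ)) :
    familyTrace n (familyTrace m F) = familyTrace n F := by
  have key : ∀ B : Finset ℕ, B ∩ Finset.range m ∩ Finset.range n = B ∩ Finset.range n := by
    intro B
    rw [Finset.inter_assoc, Finset.inter_eq_right.mpr (Finset.range_subset_range.mpr h)]
  ext A
  simp only [mem_familyTrace]
  constructor
  · rintro ⟨hA, _, ⟨-, B, hB, rfl⟩, rfl⟩
    exact ⟨hA, B, hB, (key B).symm⟩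
  · rintro ⟨hA, B, hB, rfl⟩
    refine ⟨hA, _, ⟨?_, B, hB, rfl⟩, key B⟩
    rw [← key B] at hA
    exact hA.mono Finset.inter_subset_left

namespace IsGregFamily

variable {n : ℕ} {F : Finset (Finset ℕ)}

theorem pos (h : IsGregFamily n F) : 0 < n := by
  simpa [Nat.pos_iff_ne_zero] using h.nonempty _ h.univ_mem

theorem familyTrace_self (h : IsGregFamily n F) : familyTrace n F = F := by
  ext A
  rw [mem_familyTrace]
  constructor
  · rintro ⟨-, B, hB, rfl⟩
    rwa [Finset.inter_eq_left.mpr (h.subset B hB)]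
  · intro hA
    exact ⟨h.nonempty A hA, A, hA, Finset.inter_eq_left.mpr (h.subset A hA)⟩

/-- Inducing a family of clusters on fewer labels gives a family of clusters. -/
theorem induced {m : ℕ} (h : IsGregFamily m F) (hn : 0 < n) (hm : n ≤ m) :
    IsGregFamily n (familyTrace n F) where
  nonempty A hA := (mem_familyTrace.mp hA).1
  subset A hA := by
    obtain ⟨-, B, -, rfl⟩ := mem_familyTrace.mp hA
    exact Finset.inter_subset_right
  univ_mem := mem_familyTrace.mpr ⟨by simpa using hn.ne', _, h.univ_mem,
    Finset.inter_eq_right.mpr (Finset.range_subset_range.mpr hm)⟩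
  laminar A hA B hB := by
    obtain ⟨-, A, hA', rfl⟩ := mem_familyTrace.mp hA
    obtain ⟨-, B, hB', rfl⟩ := mem_familyTrace.mp hB
    rcases h.laminar A hA' B hB' with h | h | h
    · exact Or.inl (Finset.inter_subset_inter_right h)
    · exact Or.inr (Or.inl (Finset.inter_subset_inter_right h))
    · exact Or.inr (Or.inr (h.mono Finset.inter_subset_left Finset.inter_subset_left))
  root A hA h0 := by
    obtain ⟨-, A, hA', rfl⟩ := mem_familyTrace.mp hA
    rw [h.root A hA' (Finset.mem_inter.mp h0).1]
    exact Finset.inter_eq_right.mpr (Finset.range_subset_range.mpr hm)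
  sep i hi j hj hij := by
    obtain ⟨A, hA, h1⟩ := h.sep i (by omega) j (by omega) hij
    have hiff : ¬ (i ∈ A ∩ Finset.range n ↔ j ∈ A ∩ Finset.range n) := by simpa [hi, hj] using h1
    refine ⟨A ∩ Finset.range n, mem_familyTrace.mpr ⟨?_, A, hA, rfl⟩, hiff⟩
    rw [Finset.nonempty_iff_ne_empty]
    intro h0
    simp [h0] at hiff

theorem exists_least (h : IsGregFamily n F) {i : ℕ} (hi : i < n) :
    ∃ A ∈ F, i ∈ A ∧ ∀ B ∈ F, i ∈ B → A ⊆ B := by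
  obtain ⟨A, hA, hmin⟩ := Finset.exists_min_image (F.filter (i ∈ ·)) Finset.card
    ⟨Finset.range n, by simp [h.univ_mem, hi]⟩
  rw [Finset.mem_filter] at hA
  refine ⟨A, hA.1, hA.2, fun B hB hiB => ?_⟩
  rcases h.laminar A hA.1 B hB with h1 | h1 | h1
  · exact h1
  · rw [Finset.eq_of_subset_of_card_le h1 (hmin B (by simp [hB, hiB]))]
  · exact absurd hiB (Finset.disjoint_left.mp h1 hA.2)

end IsGregFamily

/-- A cluster is labeled if it is the least cluster containing some label. -/
def IsLabeledCluster (F : Finset (Finset ℕ)) (A : Finset ℕ) : Prop :=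
  ∃ i ∈ A, ∀ B ∈ F, i ∈ B → A ⊆ B

open Classical in
/-- There are as many labeled clusters as labels, because distinct labels are separated. -/
theorem IsGregFamily.card_labeled {n : ℕ} {F : Finset (Finset ℕ)} (h : IsGregFamily n F) :
    (F.filter (IsLabeledCluster F)).card = n := by
  choose! cl hcl using fun i (hi : i < n) => h.exists_least hi
  have himage : F.filter (IsLabeledCluster F) = (Finset.range n).image cl := by
    ext A
    simp only [Finset.mem_filter, Finset.mem_image, Finset.mem_range]
    constructor
    · rintro ⟨hA, i, hi, hmin⟩
      have hin : i < n := by simpa using h.subset A hA hi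
      obtain ⟨h1, h2, h3⟩ := hcl i hin
      exact ⟨i, hin, (h3 A hA hi).antisymm (hmin _ h1 h2)⟩
    · rintro ⟨i, hi, rfl⟩
      obtain ⟨h1, h2, h3⟩ := hcl i hi
      exact ⟨h1, i, h2, h3⟩
  rw [himage, Finset.card_image_of_injOn, Finset.card_range]
  intro i hi j hj hij
  by_contra hne
  simp only [Finset.coe_range, Set.mem_Iio] at hi hj
  obtain ⟨A, hA, hAij⟩ := h.sep i hi j hj hne
  obtain ⟨-, h2, h3⟩ := hcl i hi
  obtain ⟨-, k2, k3⟩ := hcl j hj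
  exact hAij ⟨fun hi => h3 A hA hi (hij ▸ k2), fun hj => k3 A hA hj (hij ▸ h2)⟩

theorem IsGregFamily.le_card {n : ℕ} {F : Finset (Finset ℕ)} (h : IsGregFamily n F) :
    n ≤ F.card := by
  classical
  conv_lhs => rw [← h.card_labeled]
  exact Finset.card_filter_le _ _

/-- The result of adding the label `n` to the clusters containing `A`. -/
def addLabel (n : ℕ) (A B : Finset ℕ) : Finset ℕ :=
  if A ⊆ B then insert n B else B

/-- The family obtained from `F` by inserting the label `n` at the cluster `A`. The four choices of
`leaf` (whether `n` becomes a leaf) and `keep` (whether `A` remains a cluster, so that the edge above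
it has been subdivided) correspond to: labeling the vertex `A`, labeling a new vertex on the
edge above `A`, attaching a new leaf to `A`, and attaching a new leaf to a new vertex on the edge
above `A`. -/
def insertLabel (n : ℕ) (F : Finset (Finset ℕ)) (A : Finset ℕ) (leaf keep : Bool) :
    Finset (Finset ℕ) :=
  F.image (addLabel n A) ∪ (if leaf then {{n}} else ∅) ∪ (if keep then {A} else ∅)

theorem mem_insertLabel {n : ℕ} {F : Finset (Finset ℕ)} {A : Finset ℕ} {leaf keep : Bool}
    {C : Finset ℕ} : C ∈ insertLabel n F A leaf keep ↔
      (∃ B ∈ F, addLabel n A B = C) ∨ (leaf = true ∧ C = {n}) ∨ (keep = true ∧ C = A) := by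
  rw [insertLabel, Finset.mem_union, Finset.mem_union, Finset.mem_image, or_assoc]
  cases leaf <;> cases keep <;> simp

/-- The conditions under which inserting a label yields a Greg tree: only an unlabeled vertex can
be labeled, and there is no edge above the root. -/
def InsertAllowed (n : ℕ) (F : Finset (Finset ℕ)) (A : Finset ℕ) (leaf keep : Bool) : Prop :=
  (leaf = false → keep = false → ¬ IsLabeledCluster F A) ∧ (keep = true → A ≠ Finset.range n)

theorem subset_addLabel (n : ℕ) (A B : Finset ℕ) : B ⊆ addLabel n A B := by
  unfold addLabel; split_ifs <;> simp

theorem mem_addLabel_of_ne {n i : ℕ} {A B : Finset ℕ} (hi : i ≠ n) :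
    i ∈ addLabel n A B ↔ i ∈ B := by
  unfold addLabel; split_ifs <;> simp [hi]

theorem self_mem_addLabel {n : ℕ} {A B : Finset ℕ} (hB : n ∉ B) :
    n ∈ addLabel n A B ↔ A ⊆ B := by
  unfold addLabel; split_ifs with h <;> simp [hB, h]

namespace IsGregFamily

variable {n : ℕ} {F : Finset (Finset ℕ)}

theorem self_notMem (h : IsGregFamily n F) {A : Finset ℕ} (hA : A ∈ F) : n ∉ A :=
  fun hn => by simpa using h.subset A hA hn

theorem addLabel_inter (h : IsGregFamily n F) {A B : Finset ℕ} (hB : B ∈ F) :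
    addLabel n A B ∩ Finset.range n = B := by
  ext i
  by_cases hi : i = n
  · subst hi; simp [h.self_notMem hB]
  · simp only [Finset.mem_inter, mem_addLabel_of_ne hi, Finset.mem_range, and_iff_left_iff_imp]
    intro hiB
    simpa using h.subset B hB hiB

theorem addLabel_injOn (h : IsGregFamily n F) (A : Finset ℕ) :
    Set.InjOn (addLabel n A) F := by
  intro B hB C hC hBC
  rw [← h.addLabel_inter (A := A) hB, hBC, h.addLabel_inter hC]

theorem addLabel_ne_singleton (h : IsGregFamily n F) {A B : Finset ℕ} (hB : B ∈ F) :
    addLabel n A B ≠ {n} := by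
  intro h1
  have := h.addLabel_inter (A := A) hB
  rw [h1] at this
  obtain ⟨i, hi⟩ := h.nonempty B hB
  rw [← this] at hi
  simp at hi

theorem addLabel_ne_self (h : IsGregFamily n F) {A B : Finset ℕ} (hA : A ∈ F) (hB : B ∈ F) :
    addLabel n A B ≠ A := by
  intro h1
  have h2 := h.addLabel_inter (A := A) hB
  rw [h1, Finset.inter_eq_left.mpr (h.subset A hA)] at h2
  subst h2
  exact h.self_notMem hA (h1 ▸ (self_mem_addLabel (h.self_notMem hA)).mpr subset_rfl)

theorem card_insertLabel (h : IsGregFamily n F) {A : Finset ℕ} (hA : A ∈ F) (leaf keep : Bool) :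
    (insertLabel n F A leaf keep).card = F.card + leaf.toNat + keep.toNat := by
  have h1 : (F.image (addLabel n A)).card = F.card := Finset.card_image_of_injOn (h.addLabel_injOn A)
  have h2 : {n} ∉ F.image (addLabel n A) := by
    simp only [Finset.mem_image, not_exists, not_and]
    exact fun B hB => h.addLabel_ne_singleton hB
  have h3 : A ∉ F.image (addLabel n A) := by
    simp only [Finset.mem_image, not_exists, not_and]
    exact fun B hB => h.addLabel_ne_self hA hB
  have h4 : A ≠ {n} := by
    rintro rfl
    exact h.self_notMem hA (by simp)
  have h5 : A ∉ insert {n} (F.image (addLabel n A)) := by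
    rw [Finset.mem_insert]
    tauto
  cases leaf <;> cases keep <;> simp [insertLabel, h1]
  · rw [Finset.card_insert_of_notMem h3, h1]
  · rw [Finset.card_insert_of_notMem h2, h1]
  · rw [Finset.insert_comm, Finset.card_insert_of_notMem h5, Finset.card_insert_of_notMem h2, h1]

theorem familyTrace_insertLabel (h : IsGregFamily n F) {A : Finset ℕ} (hA : A ∈ F)
    (leaf keep : Bool) : familyTrace n (insertLabel n F A leaf keep) = F := by
  ext C
  rw [mem_familyTrace]
  constructor
  · rintro ⟨hC, D, hD, rfl⟩
    rcases mem_insertLabel.mp hD with ⟨B, hB, rfl⟩ | ⟨-, rfl⟩ | ⟨-, rfl⟩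
    · rwa [h.addLabel_inter hB]
    · simp at hC
    · rwa [Finset.inter_eq_left.mpr (h.subset _ hA)]
  · intro hC
    exact ⟨h.nonempty C hC, _, mem_insertLabel.mpr (Or.inl ⟨C, hC, rfl⟩), h.addLabel_inter hC⟩

theorem addLabel_laminar (h : IsGregFamily n F) {A B C : Finset ℕ} (hA : A ∈ F) (hB : B ∈ F)
    (hC : C ∈ F) : addLabel n A B ⊆ addLabel n A C ∨ addLabel n A C ⊆ addLabel n A B ∨
      Disjoint (addLabel n A B) (addLabel n A C) := by
  have hnB := h.self_notMem hB
  have hnC := h.self_notMem hC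
  have mono : ∀ {B C : Finset ℕ}, B ⊆ C → addLabel n A B ⊆ addLabel n A C := by
    intro B C hBC
    unfold addLabel
    split_ifs with h1 h2 h2
    · exact Finset.insert_subset_insert _ hBC
    · exact absurd (h1.trans hBC) h2
    · exact hBC.trans (Finset.subset_insert _ _)
    · exact hBC
  rcases h.laminar B hB C hC with h1 | h1 | h1
  · exact Or.inl (mono h1)
  · exact Or.inr (Or.inl (mono h1))
  · refine Or.inr (Or.inr ?_)
    obtain ⟨a, ha⟩ := h.nonempty A hA
    rw [Finset.disjoint_left]
    intro i hiB hiC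
    by_cases hi : i = n
    · subst hi
      exact Finset.disjoint_left.mp h1 ((self_mem_addLabel hnB).mp hiB ha)
        ((self_mem_addLabel hnC).mp hiC ha)
    · rw [mem_addLabel_of_ne hi] at hiB hiC
      exact Finset.disjoint_left.mp h1 hiB hiC

theorem addLabel_laminar_self (h : IsGregFamily n F) {A B : Finset ℕ} (hA : A ∈ F) (hB : B ∈ F) :
    addLabel n A B ⊆ A ∨ A ⊆ addLabel n A B ∨ Disjoint (addLabel n A B) A := by
  by_cases hAB : A ⊆ B
  · exact Or.inr (Or.inl (hAB.trans (subset_addLabel _ _ _)))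
  · have : addLabel n A B = B := if_neg hAB
    rw [this]
    exact h.laminar B hB A hA

theorem insertion (h : IsGregFamily n F) {A : Finset ℕ} (hA : A ∈ F) {leaf keep : Bool}
    (hal : InsertAllowed n F A leaf keep) :
    IsGregFamily (n + 1) (insertLabel n F A leaf keep) where
  nonempty C hC := by
    rcases mem_insertLabel.mp hC with ⟨B, hB, rfl⟩ | ⟨-, rfl⟩ | ⟨-, rfl⟩
    · exact (h.nonempty B hB).mono (subset_addLabel _ _ _)
    · simp
    · exact h.nonempty _ hA
  subset C hC := by
    have hsub : ∀ B ∈ F, B ⊆ Finset.range (n + 1) := fun B hB =>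
      (h.subset B hB).trans (Finset.range_subset_range.mpr (Nat.le_succ n))
    rcases mem_insertLabel.mp hC with ⟨B, hB, rfl⟩ | ⟨-, rfl⟩ | ⟨-, rfl⟩
    · unfold addLabel
      split_ifs
      · exact Finset.insert_subset (by simp) (hsub B hB)
      · exact hsub B hB
    · simp
    · exact hsub _ hA
  univ_mem := mem_insertLabel.mpr (Or.inl ⟨_, h.univ_mem, by
    rw [addLabel, if_pos (h.subset A hA), Finset.range_add_one]⟩)
  laminar C hC D hD := by
    have hsing : ∀ E : Finset ℕ, {n} ⊆ E ∨ E ⊆ {n} ∨ Disjoint {n} E := by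
      intro E
      by_cases hn : n ∈ E
      · exact Or.inl (by simpa using hn)
      · exact Or.inr (Or.inr (by simpa using hn))
    rcases mem_insertLabel.mp hC with ⟨B, hB, rfl⟩ | ⟨-, rfl⟩ | ⟨-, rfl⟩
    · rcases mem_insertLabel.mp hD with ⟨B', hB', rfl⟩ | ⟨-, rfl⟩ | ⟨-, rfl⟩
      · exact h.addLabel_laminar hA hB hB'
      · have := hsing (addLabel n A B)
        rw [disjoint_comm] at this
        tauto
      · exact h.addLabel_laminar_self hA hB
    · exact hsing D
    · rcases mem_insertLabel.mp hD with ⟨B', hB', rfl⟩ | ⟨-, rfl⟩ | ⟨-, rfl⟩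
      · have := h.addLabel_laminar_self hA hB'
        rw [disjoint_comm] at this
        tauto
      · have := hsing C
        rw [disjoint_comm] at this
        tauto
      · simp
  root C hC h0 := by
    have hn := h.pos
    rcases mem_insertLabel.mp hC with ⟨B, hB, rfl⟩ | ⟨-, rfl⟩ | ⟨hk, rfl⟩
    · rw [mem_addLabel_of_ne hn.ne] at h0
      rw [h.root B hB h0, addLabel, if_pos (h.subset A hA), Finset.range_add_one]
    · simp at h0; omega
    · exact absurd (h.root _ hA h0) (hal.2 hk)
  sep := by
    -- The new label is separated from an old label `i`.
    have hnew : ∀ i < n, ∃ C ∈ insertLabel n F A leaf keep, ¬ (i ∈ C ↔ n ∈ C) := by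
      intro i hi
      by_cases hiA : i ∈ A
      · cases leaf with
        | true => exact ⟨{n}, mem_insertLabel.mpr (Or.inr (Or.inl ⟨rfl, rfl⟩)), by simp; omega⟩
        | false =>
          cases keep with
          | true => exact ⟨A, mem_insertLabel.mpr (Or.inr (Or.inr ⟨rfl, rfl⟩)),
              by simp [hiA, h.self_notMem hA]⟩
          | false =>
            have h1 := hal.1 rfl rfl
            simp only [IsLabeledCluster, not_exists, not_and, not_forall] at h1
            obtain ⟨B, hB, hiB, hAB⟩ := h1 i hiA
            refine ⟨_, mem_insertLabel.mpr (Or.inl ⟨B, hB, rfl⟩), ?_⟩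
            rw [mem_addLabel_of_ne hi.ne, self_mem_addLabel (h.self_notMem hB)]
            tauto
      · refine ⟨_, mem_insertLabel.mpr (Or.inl ⟨A, hA, rfl⟩), ?_⟩
        rw [mem_addLabel_of_ne hi.ne, self_mem_addLabel (h.self_notMem hA)]
        simp [hiA]
    intro i hi j hj hij
    by_cases hin : i = n
    · obtain ⟨C, hC, h1⟩ := hnew j (by omega)
      exact ⟨C, hC, by rw [hin]; tauto⟩
    · by_cases hjn : j = n
      · rw [hjn]
        exact hnew i (by omega)
      · obtain ⟨B, hB, h1⟩ := h.sep i (by omega) j (by omega) hij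
        refine ⟨_, mem_insertLabel.mpr (Or.inl ⟨B, hB, rfl⟩), ?_⟩
        rwa [mem_addLabel_of_ne hin, mem_addLabel_of_ne hjn]

theorem insertLabel_subset_of_eq (h : IsGregFamily n F) {A A' : Finset ℕ} (hA : A ∈ F)
    (hA' : A' ∈ F) {l k l' k' : Bool}
    (heq : insertLabel n F A l k = insertLabel n F A' l' k') : A' ⊆ A := by
  have h1 : addLabel n A A ∈ insertLabel n F A' l' k' :=
    heq ▸ mem_insertLabel.mpr (Or.inl ⟨A, hA, rfl⟩)
  have hn : n ∈ addLabel n A A := (self_mem_addLabel (h.self_notMem hA)).mpr subset_rfl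
  rcases mem_insertLabel.mp h1 with ⟨B, hB, h2⟩ | ⟨-, h2⟩ | ⟨-, h2⟩
  · have h3 := h.addLabel_inter (A := A) hA
    rw [← h2, h.addLabel_inter hB] at h3
    subst h3
    rw [← h2] at hn
    exact (self_mem_addLabel (h.self_notMem hB)).mp hn
  · exact absurd h2 (h.addLabel_ne_singleton hA)
  · rw [h2] at hn
    exact absurd hn (h.self_notMem hA')

theorem insertLabel_inj (h : IsGregFamily n F) {A A' : Finset ℕ} (hA : A ∈ F)
    (hA' : A' ∈ F) {l k l' k' : Bool}
    (heq : insertLabel n F A l k = insertLabel n F A' l' k') :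
    A = A' ∧ l = l' ∧ k = k' := by
  obtain rfl : A = A' := (h.insertLabel_subset_of_eq hA' hA heq.symm).antisymm
    (h.insertLabel_subset_of_eq hA hA' heq)
  have hne : A ≠ {n} := by
    rintro rfl
    exact h.self_notMem hA (by simp)
  have h1 : ∀ l k, {n} ∈ insertLabel n F A l k ↔ l = true := by
    intro l k
    rw [mem_insertLabel]
    constructor
    · rintro (⟨B, hB, h2⟩ | ⟨h2, -⟩ | ⟨-, h2⟩)
      · exact absurd h2 (h.addLabel_ne_singleton hB)
      · exact h2
      · exact absurd h2.symm hne
    · intro hl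
      exact Or.inr (Or.inl ⟨hl, rfl⟩)
  have h2 : ∀ l k, A ∈ insertLabel n F A l k ↔ k = true := by
    intro l k
    rw [mem_insertLabel]
    constructor
    · rintro (⟨B, hB, h2⟩ | ⟨-, h2⟩ | ⟨h2, -⟩)
      · exact absurd h2 (h.addLabel_ne_self hA hB)
      · exact absurd h2 hne
      · exact h2
    · intro hl
      exact Or.inr (Or.inr ⟨hl, rfl⟩)
  refine ⟨rfl, ?_, ?_⟩
  · rw [Bool.eq_iff_iff, ← h1 l k, heq, h1]
  · rw [Bool.eq_iff_iff, ← h2 l k, heq, h2]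

/-- Every family on one more label arises from its trace by inserting the label. The cluster at
which it is inserted comes from the least cluster other than `{n}` that contains `n`. -/
theorem exists_insertLabel_eq {F₁ : Finset (Finset ℕ)} (h : IsGregFamily n F)
    (h₁ : IsGregFamily (n + 1) F₁) (htr : familyTrace n F₁ = F) :
    ∃ A ∈ F, ∃ leaf keep, InsertAllowed n F A leaf keep ∧
      insertLabel n F A leaf keep = F₁ := by
  classical
  have hpos := h.pos
  obtain ⟨M, hM, hmin⟩ := Finset.exists_min_image
    (F₁.filter fun B => n ∈ B ∧ B ≠ {n}) Finset.card
    ⟨Finset.range (n + 1), by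
      simp only [Finset.mem_filter, h₁.univ_mem, Finset.self_mem_range_succ, true_and]
      intro h0
      have : 0 ∈ ({n} : Finset ℕ) := h0 ▸ by simp
      simp at this
      omega⟩
  obtain ⟨hMF, hnM, hMn⟩ := Finset.mem_filter.mp hM
  have hmin' : ∀ B ∈ F₁, n ∈ B → B ≠ {n} → M ⊆ B := by
    intro B hB hnB hBn
    rcases h₁.laminar M hMF B hB with h1 | h1 | h1
    · exact h1
    · rw [Finset.eq_of_subset_of_card_le h1 (hmin B (by simp [hB, hnB, hBn]))]
    · exact absurd hnB (Finset.disjoint_left.mp h1 hnM)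
  have hlt : ∀ B ∈ F₁, ∀ i ∈ B, i ≠ n → i < n := by
    intro B hB i hi hin
    have : i < n + 1 := by simpa using h₁.subset B hB hi
    omega
  have hinterF : ∀ B ∈ F₁, B ≠ {n} → B ∩ Finset.range n ∈ F := by
    intro B hB hBn
    rw [← htr, mem_familyTrace]
    refine ⟨?_, B, hB, rfl⟩
    obtain ⟨i, hi, hin⟩ : ∃ i ∈ B, i ≠ n := by
      by_contra hcon
      push Not at hcon
      exact hBn (Finset.eq_singleton_iff_nonempty_unique_mem.mpr ⟨h₁.nonempty B hB, hcon⟩)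
    exact ⟨i, by simp [hi, hlt B hB i hi hin]⟩
  have hinter_eq : ∀ B ∈ F₁, n ∉ B → B ∩ Finset.range n = B := by
    intro B hB hnB
    refine Finset.inter_eq_left.mpr fun i hi => ?_
    have : i ≠ n := fun h0 => hnB (h0 ▸ hi)
    simpa using hlt B hB i hi this
  have hinsert : ∀ B ∈ F₁, n ∈ B → insert n (B ∩ Finset.range n) = B := by
    intro B hB hnB
    ext i
    by_cases hi : i = n
    · simp [hi, hnB]
    · simp only [Finset.mem_insert, hi, Finset.mem_inter, Finset.mem_range, false_or,
        and_iff_left_iff_imp]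
      exact fun h1 => hlt B hB i h1 hi
  set A := M ∩ Finset.range n with hAdef
  have hAF : A ∈ F := hinterF M hMF hMn
  have hAM : A ⊆ M := Finset.inter_subset_left
  have hadd : ∀ B ∈ F₁, B ≠ {n} → B ≠ A → addLabel n A (B ∩ Finset.range n) = B := by
    intro B hB hBn hBA
    by_cases hnB : n ∈ B
    · rw [addLabel, if_pos (Finset.inter_subset_inter_right (hmin' B hB hnB hBn)), hinsert B hB hnB]
    · rw [hinter_eq B hB hnB, addLabel, if_neg]
      intro hAB
      obtain ⟨i, hi⟩ := h.nonempty A hAF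
      rcases h₁.laminar M hMF B hB with h1 | h1 | h1
      · exact hnB (h1 hnM)
      · refine hBA (Finset.Subset.antisymm ?_ hAB)
        rw [← hinter_eq B hB hnB]
        exact Finset.inter_subset_inter_right h1
      · exact Finset.disjoint_left.mp h1 (hAM hi) (hAB hi)
  refine ⟨A, hAF, decide ({n} ∈ F₁), decide (A ∈ F₁), ⟨?_, ?_⟩, ?_⟩
  · simp only [decide_eq_false_iff_not]
    rintro hleaf hkeep ⟨i, hiA, hi⟩
    have hin : i < n := by simpa using h.subset A hAF hiA
    obtain ⟨C, hC, hsep⟩ := h₁.sep i (by omega) n (by omega) hin.ne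
    have hCn : C ≠ {n} := fun h0 => hleaf (h0 ▸ hC)
    by_cases hnC : n ∈ C
    · exact hsep (by simp [hnC, hmin' C hC hnC hCn (hAM hiA)])
    · have hiC : i ∈ C := by tauto
      have hCA : C ≠ A := fun h0 => hkeep (h0 ▸ hC)
      have hCF := hinterF C hC hCn
      rw [hinter_eq C hC hnC] at hCF
      have h2 := hadd C hC hCn hCA
      rw [hinter_eq C hC hnC, addLabel, if_pos (hi C hCF hiC)] at h2
      exact hnC (h2 ▸ Finset.mem_insert_self _ _)
  · simp only [decide_eq_true_eq]
    intro hA1 hA2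
    have := h₁.root A hA1 (by rw [hA2]; simpa using hpos)
    rw [hA2] at this
    simpa using congrArg Finset.card this
  · ext C
    rw [mem_insertLabel]
    simp only [decide_eq_true_eq]
    constructor
    · rintro (⟨B, hB, rfl⟩ | ⟨h1, rfl⟩ | ⟨h1, rfl⟩)
      · rw [← htr, mem_familyTrace] at hB
        obtain ⟨hBne, D, hD, rfl⟩ := hB
        by_cases hDA : D = A
        · have : D ∩ Finset.range n = A := by rw [hDA, Finset.inter_eq_left.mpr (h.subset A hAF)]
          rw [this, addLabel, if_pos subset_rfl, hinsert M hMF hnM]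
          exact hMF
        · rw [hadd D hD _ hDA]
          · exact hD
          · rintro rfl
            simp at hBne
      · exact h1
      · exact h1
    · intro hC
      by_cases hCn : C = {n}
      · exact Or.inr (Or.inl ⟨hCn ▸ hC, hCn⟩)
      · by_cases hCA : C = A
        · exact Or.inr (Or.inr ⟨hCA ▸ hC, hCA⟩)
        · exact Or.inl ⟨_, hinterF C hC hCn, hadd C hC hCn hCA⟩

open Classical in
/-- Summation over the ways of inserting one more label. -/
theorem sum_familyTrace_eq (h : IsGregFamily n F) (g : ℕ → ℚ) :
    ∑ F₁ ∈ (gregFamilies (n + 1)).filter (fun F₁ => familyTrace n F₁ = F), g F₁.card =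
      (F.card - n : ℕ) * g F.card + (2 * F.card - 1 : ℕ) * g (F.card + 1) +
        (F.card - 1 : ℕ) * g (F.card + 2) := by
  have hlab : (F.filter fun A => ¬ IsLabeledCluster F A).card = F.card - n := by
    have h1 := Finset.card_filter_add_card_filter_not (s := F) (IsLabeledCluster F)
    have h2 := h.card_labeled
    omega
  have hroot : (F.filter fun A => A ≠ Finset.range n).card = F.card - 1 := by
    rw [Finset.filter_ne', Finset.card_erase_of_mem h.univ_mem]
  have hcard : 1 ≤ F.card := h.pos.trans_le h.le_card
  set I := (F ×ˢ (Finset.univ : Finset (Bool × Bool))).filter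
    fun p => InsertAllowed n F p.1 p.2.1 p.2.2
  have hI : ∑ p ∈ I, g (F.card + p.2.1.toNat + p.2.2.toNat) =
      ∑ F₁ ∈ (gregFamilies (n + 1)).filter (fun F₁ => familyTrace n F₁ = F), g F₁.card := by
    refine Finset.sum_bij (fun p _ => insertLabel n F p.1 p.2.1 p.2.2) ?_ ?_ ?_ ?_
    · rintro ⟨A, l, k⟩ hp
      simp only [I, Finset.mem_filter, Finset.mem_product, Finset.mem_univ, and_true] at hp
      exact Finset.mem_filter.mpr ⟨mem_gregFamilies.mpr (h.insertion hp.1 hp.2),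
        h.familyTrace_insertLabel hp.1 l k⟩
    · rintro ⟨A, l, k⟩ hp ⟨A', l', k'⟩ hp' heq
      simp only [I, Finset.mem_filter, Finset.mem_product, Finset.mem_univ, and_true] at hp hp'
      obtain ⟨rfl, rfl, rfl⟩ := h.insertLabel_inj hp.1 hp'.1 heq
      rfl
    · intro F₁ hF₁
      obtain ⟨hF₁, htr⟩ := Finset.mem_filter.mp hF₁
      obtain ⟨A, hA, l, k, hal, heq⟩ := h.exists_insertLabel_eq (mem_gregFamilies.mp hF₁) htr
      exact ⟨(A, l, k), by simp [I, hA, hal], heq⟩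
    · rintro ⟨A, l, k⟩ hp
      simp only [I, Finset.mem_filter, Finset.mem_product, Finset.mem_univ, and_true] at hp
      rw [h.card_insertLabel hp.1]
  rw [← hI, Finset.sum_filter, Finset.sum_product]
  simp only [Fintype.sum_prod_type, Fintype.sum_bool, InsertAllowed, Finset.sum_add_distrib]
  simp only [Bool.true_eq_false, Bool.toNat_true, Bool.toNat_false, forall_const, IsEmpty.forall_iff,
    Bool.false_eq_true, true_and, and_true, if_true, add_zero, ← Finset.sum_filter, Finset.sum_const,
    hlab, hroot, nsmul_eq_mul]
  rw [show 2 * F.card - 1 = F.card + (F.card - 1) by omega]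
  push_cast
  ring

end IsGregFamily

open Classical in
/-- The number of families of `n + k` clusters on `n + k` labels that induce `F` on the first `n`
labels; these are the families of Cayley trees of size `n + k`. -/
noncomputable def cayleyFamilyCount (n k : ℕ) (F : Finset (Finset ℕ)) : ℕ :=
  ((gregFamilies (n + k)).filter fun F' => F'.card = n + k ∧ familyTrace n F' = F).card

/-- Inducing on the first `n` labels factors through inducing on the first `n + 1` labels. -/
theorem cayleyFamilyCount_succ {n k : ℕ} {F : Finset (Finset ℕ)} :
    cayleyFamilyCount n (k + 1) F =
      ∑ F₁ ∈ (open Classical in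
        (gregFamilies (n + 1)).filter (fun F₁ => familyTrace n F₁ = F)),
        cayleyFamilyCount (n + 1) k F₁ := by
  classical
  have e : n + (k + 1) = n + 1 + k := by ring
  unfold cayleyFamilyCount
  rw [e, Finset.card_eq_sum_card_fiberwise (f := familyTrace (n + 1))
    (t := (gregFamilies (n + 1)).filter fun F₁ => familyTrace n F₁ = F)]
  · refine Finset.sum_congr rfl fun F₁ hF₁ => ?_
    congr 1
    ext F'
    have h1 := (Finset.mem_filter.mp hF₁).2
    simp only [Finset.mem_filter]
    constructor
    · tauto
    · rintro ⟨h2, h3, rfl⟩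
      rw [familyTrace_familyTrace (Nat.le_succ n)] at h1
      tauto
  · intro F' hF'
    simp only [Finset.coe_filter, Set.mem_ofPred_eq] at hF' ⊢
    rw [familyTrace_familyTrace (Nat.le_succ n)]
    exact ⟨mem_gregFamilies.mpr ((mem_gregFamilies.mp hF'.1).induced (by omega) (by omega)),
      hF'.2.2⟩

theorem cayleyFamilyCount_zero {n : ℕ} {F : Finset (Finset ℕ)} (h : IsGregFamily n F) :
    cayleyFamilyCount n 0 F = if F.card = n then 1 else 0 := by
  classical
  unfold cayleyFamilyCount
  have : ((gregFamilies (n + 0)).filter fun F' => F'.card = n + 0 ∧ familyTrace n F' = F) =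
      if F.card = n then {F} else ∅ := by
    ext F'
    simp only [Finset.mem_filter, mem_gregFamilies, add_zero]
    constructor
    · rintro ⟨h1, h2, h3⟩
      rw [h1.familyTrace_self] at h3
      subst h3
      simp [h2]
    · split_ifs with hF
      · simp only [Finset.mem_singleton]
        rintro rfl
        exact ⟨h, hF, h.familyTrace_self⟩
      · simp
  rw [this]
  split_ifs <;> simp

open PowerSeries in
/-- The number of Cayley families inducing `F` is given by the coefficients of `gregSeries`: both
satisfy the same recurrence. -/
theorem coeff_gregSeries (k : ℕ) : ∀ {n : ℕ} {F : Finset (Finset ℕ)}, IsGregFamily n F →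
    (cayleyFamilyCount n k F : ℚ) / k.factorial = coeff k (gregSeries n (F.card - n)) := by
  classical
  induction k with
  | zero =>
    intro n F h
    have := h.le_card
    rw [cayleyFamilyCount_zero h, coeff_zero_eq_constantCoeff_apply, constantCoeff_gregSeries]
    have e : F.card - n = 0 ↔ F.card = n := by omega
    simp [e]
  | succ k ih =>
    intro n F h
    have hle := h.le_card
    have hpos := h.pos
    have h1 := congrArg (coeff k) (derivative_gregSeries n (F.card - n) hpos)
    rw [coeff_derivative] at h1
    have h2 := h.sum_familyTrace_eq fun c => coeff k (gregSeries (n + 1) (c - (n + 1)))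
    have h3 : (cayleyFamilyCount n (k + 1) F : ℚ) / k.factorial =
        ∑ F₁ ∈ (gregFamilies (n + 1)).filter (fun F₁ => familyTrace n F₁ = F),
          coeff k (gregSeries (n + 1) (F₁.card - (n + 1))) := by
      rw [cayleyFamilyCount_succ, Nat.cast_sum, Finset.sum_div]
      refine Finset.sum_congr rfl fun F₁ hF₁ => ih (mem_gregFamilies.mp (Finset.mem_filter.mp hF₁).1)
    have hcast : ∀ (m : ℕ) (f : PowerSeries ℚ), coeff k ((m : PowerSeries ℚ) * f) = m * coeff k f := by
      intro m f
      rw [← nsmul_eq_mul, map_nsmul, nsmul_eq_mul]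
    rw [map_add, map_add, hcast, hcast, hcast] at h1
    rw [h2] at h3
    rw [show n + (F.card - n) = F.card by omega] at h1
    rw [show F.card + 1 - (n + 1) = F.card - n by omega,
      show F.card + 2 - (n + 1) = F.card - n + 1 by omega,
      show F.card - (n + 1) = F.card - n - 1 by omega, ← h1] at h3
    rw [Nat.factorial_succ]
    push_cast
    have : (k : ℚ) + 1 ≠ 0 := by positivity
    field_simp at h3 ⊢
    linear_combination h3

/-! ### Rooted trees and their clusters -/

/-- `par` is the parent function of a tree with vertex set `S`, adjacency relation `Adj` and
root `r`; the root is its own parent. -/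
structure IsRooted {V : Type} (S : Set V) (Adj : V → V → Prop) (r : V) (par : V → V) : Prop where
  root_mem : r ∈ S
  par_mem : ∀ v ∈ S, par v ∈ S
  par_root : par r = r
  reach : ∀ v ∈ S, ∃ k, par^[k] v = r
  adj_iff : ∀ a b, Adj a b ↔ a ∈ S ∧ b ∈ S ∧ a ≠ b ∧ (par a = b ∨ par b = a)

/-- `v` is an ancestor of `w` (possibly `w` itself) for the parent function `par`. -/
def IsAncestor {V : Type} (par : V → V) (v w : V) : Prop :=
  ∃ k, par^[k] w = v

namespace IsAncestor

variable {V : Type} {par : V → V} {u v w : V}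

theorem refl (v : V) : IsAncestor par v v := ⟨0, rfl⟩

theorem parent (v : V) : IsAncestor par (par v) v := ⟨1, rfl⟩

theorem trans (h₁ : IsAncestor par u v) (h₂ : IsAncestor par v w) : IsAncestor par u w := by
  obtain ⟨k, rfl⟩ := h₁
  obtain ⟨l, rfl⟩ := h₂
  exact ⟨k + l, by rw [Function.iterate_add_apply]⟩

theorem total (h₁ : IsAncestor par u w) (h₂ : IsAncestor par v w) :
    IsAncestor par u v ∨ IsAncestor par v u := by
  obtain ⟨k, rfl⟩ := h₁
  obtain ⟨l, rfl⟩ := h₂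
  rcases le_total k l with h | h
  · exact Or.inr ⟨l - k, by rw [← Function.iterate_add_apply, Nat.sub_add_cancel h]⟩
  · exact Or.inl ⟨k - l, by rw [← Function.iterate_add_apply, Nat.sub_add_cancel h]⟩

theorem of_ne (h : IsAncestor par v w) (hne : v ≠ w) : IsAncestor par v (par w) := by
  obtain ⟨_ | k, rfl⟩ := h
  · exact absurd rfl hne
  · exact ⟨k, rfl⟩

theorem exists_child (h : IsAncestor par v w) (hne : v ≠ w) :
    ∃ c, par c = v ∧ c ≠ v ∧ IsAncestor par c w := by
  obtain ⟨k, hk⟩ := h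
  induction k with
  | zero => exact absurd hk.symm hne
  | succ k ih =>
    by_cases h : par^[k] w = v
    · exact ih h
    · exact ⟨par^[k] w, by rw [← hk, Function.iterate_succ_apply'], h, k, rfl⟩

end IsAncestor

namespace IsRooted

variable {V : Type} {S : Set V} {Adj : V → V → Prop} {r : V} {par : V → V}

theorem iterate_root (h : IsRooted S Adj r par) (k : ℕ) : par^[k] r = r :=
  Function.iterate_fixed h.par_root k

theorem mem_of_isAncestor (h : IsRooted S Adj r par) {v w : V} (hw : w ∈ S)
    (hvw : IsAncestor par v w) : v ∈ S := by
  obtain ⟨k, rfl⟩ := hvw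
  induction k generalizing w with
  | zero => exact hw
  | succ k ih => exact ih (h.par_mem w hw)

theorem eq_root_of_isAncestor (h : IsRooted S Adj r par) {v : V} (hv : IsAncestor par v r) :
    v = r := by
  obtain ⟨k, rfl⟩ := hv
  exact h.iterate_root k

theorem isAncestor_antisymm (h : IsRooted S Adj r par) {v w : V} (hv : v ∈ S)
    (h₁ : IsAncestor par v w) (h₂ : IsAncestor par w v) : v = w := by
  obtain ⟨k, hk⟩ := h₁
  obtain ⟨l, hl⟩ := h₂
  obtain ⟨N, hN⟩ := h.reach v hv
  rcases Nat.eq_zero_or_pos k with rfl | hpos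
  · exact hk.symm
  -- A proper cycle can be iterated until it passes through the root, which is a fixed point.
  · have hcyc : par^[k + l] v = v := by rw [Function.iterate_add_apply, hl, hk]
    have h1 : par^[(k + l) * N] v = v := by
      rw [Function.iterate_mul]
      exact Function.iterate_fixed hcyc N
    have h2 : N ≤ (k + l) * N := Nat.le_mul_of_pos_left N (by omega)
    have h3 : v = r := by
      rw [← h1, ← Nat.sub_add_cancel h2, Function.iterate_add_apply, hN, h.iterate_root]
    rw [h3, h.iterate_root] at hl
    rw [h3, hl]

theorem par_ne (h : IsRooted S Adj r par) {v : V} (hv : v ∈ S) (hvr : v ≠ r) : par v ≠ v := by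
  intro h1
  obtain ⟨k, hk⟩ := h.reach v hv
  rw [Function.iterate_fixed h1] at hk
  exact hvr hk

theorem par_par_ne (h : IsRooted S Adj r par) {v : V} (hv : v ∈ S) (hvr : v ≠ r) :
    par (par v) ≠ v := by
  intro h1
  exact h.par_ne hv hvr (h.isAncestor_antisymm hv ⟨1, h1⟩ (IsAncestor.parent v)).symm

theorem adj_par (h : IsRooted S Adj r par) {v : V} (hv : v ∈ S) (hvr : v ≠ r) : Adj v (par v) :=
  (h.adj_iff _ _).mpr ⟨hv, h.par_mem v hv, (h.par_ne hv hvr).symm, Or.inl rfl⟩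

/-- A rooted tree has only one parent function. -/
theorem par_unique (h : IsRooted S Adj r par) {par' : V → V} (h' : IsRooted S Adj r par') {v : V}
    (hv : v ∈ S) : par' v = par v := by
  obtain ⟨k, hk⟩ := h.reach v hv
  induction k generalizing v with
  | zero =>
    obtain rfl : v = r := hk
    rw [h.par_root, h'.par_root]
  | succ k ih =>
    by_cases hvr : v = r
    · rw [hvr, h.par_root, h'.par_root]
    · have h1 := ih (h.par_mem v hv) hk
      obtain ⟨-, -, -, h2 | h2⟩ := (h'.adj_iff _ _).mp (h.adj_par hv hvr)
      · exact h2
      · exact absurd (h1.symm.trans h2) (h.par_par_ne hv hvr)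

/-- The parent relation in terms of the ancestor order. -/
theorem par_eq_iff (h : IsRooted S Adj r par) {a b : V} (ha : a ∈ S) (hab : a ≠ b) :
    par a = b ↔ IsAncestor par b a ∧ ∀ v ∈ S, IsAncestor par v a → v ≠ a → IsAncestor par v b := by
  constructor
  · rintro rfl
    exact ⟨IsAncestor.parent a, fun v _ hva hne => hva.of_ne hne⟩
  · rintro ⟨h1, h2⟩
    have har : a ≠ r := by
      rintro rfl
      exact hab (h.eq_root_of_isAncestor h1).symm
    exact h.isAncestor_antisymm (h.par_mem a ha)
      (h2 _ (h.par_mem a ha) (IsAncestor.parent a) (h.par_ne ha har)) (h1.of_ne hab.symm)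

end IsRooted

open Classical in
/-- The set of labels on the descendants of `v`. -/
noncomputable def cluster {V : Type} {n : ℕ} (par : V → V) (ℓ : Fin n → V) (v : V) : Finset ℕ :=
  (Finset.range n).filter fun i => ∃ h : i < n, IsAncestor par v (ℓ ⟨i, h⟩)

theorem mem_cluster {V : Type} {n : ℕ} {par : V → V} {ℓ : Fin n → V} {v : V} {i : ℕ} :
    i ∈ cluster par ℓ v ↔ ∃ h : i < n, IsAncestor par v (ℓ ⟨i, h⟩) := by
  simp only [cluster, Finset.mem_filter, Finset.mem_range, and_iff_right_iff_imp]
  exact fun ⟨h, _⟩ => h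

theorem val_mem_cluster {V : Type} {n : ℕ} {par : V → V} {ℓ : Fin n → V} {v : V} {i : Fin n} :
    (i : ℕ) ∈ cluster par ℓ v ↔ IsAncestor par v (ℓ i) := by
  simp [mem_cluster, i.isLt]

theorem cluster_subset_range {V : Type} {n : ℕ} (par : V → V) (ℓ : Fin n → V) (v : V) :
    cluster par ℓ v ⊆ Finset.range n := by
  classical
  exact Finset.filter_subset _ _

theorem cluster_mono {V : Type} {n : ℕ} {par : V → V} {ℓ : Fin n → V} {v w : V}
    (h : IsAncestor par v w) : cluster par ℓ w ⊆ cluster par ℓ v := by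
  intro i hi
  obtain ⟨hin, h1⟩ := mem_cluster.mp hi
  exact mem_cluster.mpr ⟨hin, h.trans h1⟩

open Classical in
/-- The family of the nonempty clusters of the vertices in `S`. -/
noncomputable def clusterFamily {V : Type} {n : ℕ} (S : Set V) (par : V → V) (ℓ : Fin n → V) :
    Finset (Finset ℕ) :=
  (Finset.range n).powerset.filter fun A => A.Nonempty ∧ ∃ v ∈ S, cluster par ℓ v = A

theorem mem_clusterFamily {V : Type} {n : ℕ} {S : Set V} {par : V → V} {ℓ : Fin n → V}
    {A : Finset ℕ} :
    A ∈ clusterFamily S par ℓ ↔ A.Nonempty ∧ ∃ v ∈ S, cluster par ℓ v = A := by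
  simp only [clusterFamily, Finset.mem_filter, Finset.mem_powerset, and_iff_right_iff_imp]
  rintro ⟨-, v, -, rfl⟩
  exact cluster_subset_range _ _ _

theorem familyTrace_clusterFamily {V : Type} {n k : ℕ} (S : Set V) (par : V → V)
    (ℓ : Fin (n + k) → V) :
    familyTrace n (clusterFamily S par ℓ) = clusterFamily S par (ℓ ∘ Fin.castAdd k) := by
  have key : ∀ v, cluster par ℓ v ∩ Finset.range n = cluster par (ℓ ∘ Fin.castAdd k) v := by
    intro v
    ext i
    simp only [Finset.mem_inter, mem_cluster, Finset.mem_range, Function.comp_apply]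
    constructor
    · rintro ⟨⟨_, h1⟩, h2⟩
      exact ⟨h2, h1⟩
    · rintro ⟨h2, h1⟩
      exact ⟨⟨by omega, h1⟩, h2⟩
  ext A
  simp only [mem_familyTrace, mem_clusterFamily]
  constructor
  · rintro ⟨hA, _, ⟨-, v, hv, rfl⟩, rfl⟩
    exact ⟨hA, v, hv, (key v).symm⟩
  · rintro ⟨hA, v, hv, rfl⟩
    refine ⟨hA, _, ⟨?_, v, hv, rfl⟩, key v⟩
    rw [← key v] at hA
    exact hA.mono Finset.inter_subset_left

namespace IsRooted

variable {V : Type} {S : Set V} {Adj : V → V → Prop} {par : V → V} {n : ℕ} {ℓ : Fin n → V}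
  {hn : 0 < n}

theorem isGregFamily (h : IsRooted S Adj (ℓ ⟨0, hn⟩) par) (hℓ : Function.Injective ℓ)
    (hS : ∀ i, ℓ i ∈ S) : IsGregFamily n (clusterFamily S par ℓ) where
  nonempty A hA := (mem_clusterFamily.mp hA).1
  subset A hA := by
    obtain ⟨-, v, -, rfl⟩ := mem_clusterFamily.mp hA
    exact cluster_subset_range _ _ _
  univ_mem := mem_clusterFamily.mpr ⟨by simpa using hn.ne', _, h.root_mem, by
    refine (cluster_subset_range _ _ _).antisymm fun i hi => ?_
    have hi : i < n := by simpa using hi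
    exact mem_cluster.mpr ⟨hi, h.reach _ (hS _)⟩⟩
  laminar A hA B hB := by
    obtain ⟨-, v, -, rfl⟩ := mem_clusterFamily.mp hA
    obtain ⟨-, w, -, rfl⟩ := mem_clusterFamily.mp hB
    by_cases hd : Disjoint (cluster par ℓ v) (cluster par ℓ w)
    · exact Or.inr (Or.inr hd)
    · obtain ⟨i, hiv, hiw⟩ := Finset.not_disjoint_iff.mp hd
      obtain ⟨hi, h1⟩ := mem_cluster.mp hiv
      obtain ⟨_, h2⟩ := mem_cluster.mp hiw
      rcases h1.total h2 with h3 | h3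
      · exact Or.inr (Or.inl (cluster_mono h3))
      · exact Or.inl (cluster_mono h3)
  root A hA h0 := by
    obtain ⟨-, v, -, rfl⟩ := mem_clusterFamily.mp hA
    obtain ⟨_, h1⟩ := mem_cluster.mp h0
    rw [h.eq_root_of_isAncestor h1]
    refine (cluster_subset_range _ _ _).antisymm fun i hi => ?_
    have hi : i < n := by simpa using hi
    exact mem_cluster.mpr ⟨hi, h.reach _ (hS _)⟩
  sep i hi j hj hij := by
    have hmem : ∀ k (hk : k < n), k ∈ cluster par ℓ (ℓ ⟨k, hk⟩) := fun k hk =>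
      mem_cluster.mpr ⟨hk, IsAncestor.refl _⟩
    have hfam : ∀ k (hk : k < n), cluster par ℓ (ℓ ⟨k, hk⟩) ∈ clusterFamily S par ℓ := fun k hk =>
      mem_clusterFamily.mpr ⟨⟨k, hmem k hk⟩, _, hS _, rfl⟩
    by_contra hcon
    push Not at hcon
    obtain ⟨_, h1⟩ := mem_cluster.mp ((hcon _ (hfam i hi)).mp (hmem i hi))
    obtain ⟨_, h2⟩ := mem_cluster.mp ((hcon _ (hfam j hj)).mpr (hmem j hj))
    have h3 := hℓ (h.isAncestor_antisymm (hS _) h1 h2)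
    exact hij (by simpa using h3)

/-- In a tree without unlabeled vertices of degree less than `3`, an unlabeled vertex has a child
different from any given vertex. -/
theorem exists_child_ne (h : IsRooted S Adj (ℓ ⟨0, hn⟩) par) {v : V}
    (hdeg : 3 ≤ {w | Adj v w}.ncard) (e : V) : ∃ c ∈ S, par c = v ∧ c ≠ v ∧ c ≠ e := by
  by_contra hcon
  push Not at hcon
  have hsub : {w | Adj v w} ⊆ {par v, e} := by
    intro w hw
    obtain ⟨-, hwS, hne, h1 | h1⟩ := (h.adj_iff _ _).mp hw
    · exact Or.inl h1.symm
    · exact Or.inr (hcon w hwS h1 hne.symm)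
  have h1 := Set.ncard_le_ncard hsub (Set.toFinite _)
  have h2 := Set.ncard_insert_le (par v) {e}
  rw [Set.ncard_singleton] at h2
  omega

variable [Finite V]

theorem cluster_nonempty (h : IsRooted S Adj (ℓ ⟨0, hn⟩) par)
    (hred : ∀ v ∈ S, v ∉ Set.range ℓ → 3 ≤ {w | Adj v w}.ncard) {v : V} (hv : v ∈ S) :
    (cluster par ℓ v).Nonempty := by
  induction hm : {w | IsAncestor par v w}.ncard using Nat.strong_induction_on generalizing v with
  | _ m ih =>
    by_cases hvl : v ∈ Set.range ℓ
    · obtain ⟨i, rfl⟩ := hvl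
      exact ⟨i, val_mem_cluster.mpr (IsAncestor.refl _)⟩
    · obtain ⟨c, hcS, rfl, hne, -⟩ := h.exists_child_ne (hred v hv hvl) v
      have hlt : {w | IsAncestor par c w}.ncard < m := by
        rw [← hm]
        refine Set.ncard_lt_ncard ⟨fun w hw => (IsAncestor.parent c).trans hw, fun hsub => ?_⟩
          (Set.toFinite _)
        exact hne (h.isAncestor_antisymm hcS (hsub (IsAncestor.refl (par c)))
          (IsAncestor.parent c))
      exact (ih _ hlt hcS rfl).mono (cluster_mono (IsAncestor.parent c))

/-- In a Greg tree the clusters determine the ancestor order. -/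
theorem cluster_subset_iff (h : IsRooted S Adj (ℓ ⟨0, hn⟩) par)
    (hred : ∀ v ∈ S, v ∉ Set.range ℓ → 3 ≤ {w | Adj v w}.ncard) {v w : V} (hv : v ∈ S)
    (hw : w ∈ S) : cluster par ℓ w ⊆ cluster par ℓ v ↔ IsAncestor par v w := by
  refine ⟨fun hsub => ?_, cluster_mono⟩
  obtain ⟨i, hi⟩ := h.cluster_nonempty hred hw
  obtain ⟨hin, h1⟩ := mem_cluster.mp (hsub hi)
  obtain ⟨_, h2⟩ := mem_cluster.mp hi
  rcases h1.total h2 with h3 | h3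
  · exact h3
  by_cases hwv : w = v
  · rw [hwv]
    exact IsAncestor.refl v
  by_cases hwl : w ∈ Set.range ℓ
  · obtain ⟨j, rfl⟩ := hwl
    exact val_mem_cluster.mp (hsub (val_mem_cluster.mpr (IsAncestor.refl _)))
  -- Otherwise `v` lies below a child `c` of `w`, and `w` has another child `d`.
  · obtain ⟨c, hcw, hne, hcv⟩ := h3.exists_child hwv
    obtain ⟨d, hdS, hdw, hdne, hdc⟩ := h.exists_child_ne (hred w hw hwl) c
    obtain ⟨j, hj⟩ := h.cluster_nonempty hred hdS
    obtain ⟨hjn, h4⟩ := mem_cluster.mp hj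
    have hdj : IsAncestor par w d := ⟨1, hdw⟩
    obtain ⟨_, h5⟩ := mem_cluster.mp (hsub (cluster_mono hdj hj))
    have hcS := h.mem_of_isAncestor hv hcv
    exfalso
    rcases h4.total (hcv.trans h5) with h6 | h6
    · have h7 := h6.of_ne hdc
      rw [hcw] at h7
      exact hdne (h.isAncestor_antisymm hdS h7 hdj)
    · have h7 := h6.of_ne hdc.symm
      rw [hdw] at h7
      exact hne (h.isAncestor_antisymm hcS h7 ⟨1, hcw⟩)

theorem cluster_injOn (h : IsRooted S Adj (ℓ ⟨0, hn⟩) par)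
    (hred : ∀ v ∈ S, v ∉ Set.range ℓ → 3 ≤ {w | Adj v w}.ncard) :
    Set.InjOn (cluster par ℓ) S := by
  intro v hv w hw heq
  exact h.isAncestor_antisymm hv ((h.cluster_subset_iff hred hv hw).mp heq.ge)
    ((h.cluster_subset_iff hred hw hv).mp heq.le)

theorem bijOn_cluster (h : IsRooted S Adj (ℓ ⟨0, hn⟩) par)
    (hred : ∀ v ∈ S, v ∉ Set.range ℓ → 3 ≤ {w | Adj v w}.ncard) :
    Set.BijOn (cluster par ℓ) S (clusterFamily S par ℓ) := by
  refine ⟨fun v hv => ?_, h.cluster_injOn hred, fun A hA => ?_⟩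
  · exact mem_clusterFamily.mpr ⟨h.cluster_nonempty hred hv, v, hv, rfl⟩
  · exact (mem_clusterFamily.mp hA).2

theorem card_clusterFamily (h : IsRooted S Adj (ℓ ⟨0, hn⟩) par)
    (hred : ∀ v ∈ S, v ∉ Set.range ℓ → 3 ≤ {w | Adj v w}.ncard) :
    (clusterFamily S par ℓ).card = S.ncard := by
  have hb := h.bijOn_cluster hred
  rw [← Set.ncard_coe_finset, ← hb.image_eq, hb.injOn.ncard_image]

/-- The cluster of a labeled vertex is the least one containing the label. -/
theorem cluster_label_eq (h : IsRooted S Adj (ℓ ⟨0, hn⟩) par)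
    (hred : ∀ v ∈ S, v ∉ Set.range ℓ → 3 ≤ {w | Adj v w}.ncard) (hS : ∀ i, ℓ i ∈ S) {v : V}
    (hv : v ∈ S) (i : Fin n) :
    v = ℓ i ↔ (i : ℕ) ∈ cluster par ℓ v ∧
      ∀ A ∈ clusterFamily S par ℓ, (i : ℕ) ∈ A → cluster par ℓ v ⊆ A := by
  constructor
  · rintro rfl
    refine ⟨val_mem_cluster.mpr (IsAncestor.refl _), fun A hA hiA => ?_⟩
    obtain ⟨-, w, -, rfl⟩ := mem_clusterFamily.mp hA
    exact cluster_mono (val_mem_cluster.mp hiA)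
  · rintro ⟨h1, h2⟩
    have h3 := h2 _ ((h.bijOn_cluster hred).mapsTo (hS i)) (val_mem_cluster.mpr (IsAncestor.refl _))
    exact h.isAncestor_antisymm hv (val_mem_cluster.mp h1)
      ((h.cluster_subset_iff hred (hS i) hv).mp h3)

theorem adj_iff_cluster (h : IsRooted S Adj (ℓ ⟨0, hn⟩) par)
    (hred : ∀ v ∈ S, v ∉ Set.range ℓ → 3 ≤ {w | Adj v w}.ncard) {a b : V} (ha : a ∈ S)
    (hb : b ∈ S) :
    (a ≠ b ∧ par a = b) ↔ cluster par ℓ a ⊂ cluster par ℓ b ∧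
      ∀ A ∈ clusterFamily S par ℓ, cluster par ℓ a ⊂ A → cluster par ℓ b ⊆ A := by
  have hss : ∀ {v w}, v ∈ S → w ∈ S →
      (cluster par ℓ w ⊂ cluster par ℓ v ↔ IsAncestor par v w ∧ v ≠ w) := by
    intro v w hv hw
    rw [Finset.ssubset_iff_subset_ne, h.cluster_subset_iff hred hv hw]
    refine and_congr_right fun _ => not_congr ⟨fun h1 => (h.cluster_injOn hred hw hv h1).symm, ?_⟩
    rintro rfl
    rfl
  rw [hss hb ha]
  constructor
  · rintro ⟨hne, h1⟩
    obtain ⟨h2, h3⟩ := (h.par_eq_iff ha hne).mp h1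
    refine ⟨⟨h2, hne.symm⟩, fun A hA hlt => ?_⟩
    obtain ⟨-, v, hv, rfl⟩ := mem_clusterFamily.mp hA
    obtain ⟨h4, h5⟩ := (hss hv ha).mp hlt
    exact cluster_mono (h3 v hv h4 h5)
  · rintro ⟨⟨h2, hne⟩, h3⟩
    refine ⟨hne.symm, (h.par_eq_iff ha hne.symm).mpr ⟨h2, fun v hv h4 h5 => ?_⟩⟩
    exact (h.cluster_subset_iff hred hv hb).mp
      (h3 _ ((h.bijOn_cluster hred).mapsTo hv) ((hss hv ha).mpr ⟨h4, h5⟩))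

/-- Greg trees with the same family of clusters are isomorphic. -/
theorem exists_equiv (h : IsRooted S Adj (ℓ ⟨0, hn⟩) par)
    (hred : ∀ v ∈ S, v ∉ Set.range ℓ → 3 ≤ {w | Adj v w}.ncard) (hS : ∀ i, ℓ i ∈ S)
    {V' : Type} [Finite V'] {S' : Set V'} {Adj' : V' → V' → Prop} {par' : V' → V'} {ℓ' : Fin n → V'}
    (h' : IsRooted S' Adj' (ℓ' ⟨0, hn⟩) par')
    (hred' : ∀ v ∈ S', v ∉ Set.range ℓ' → 3 ≤ {w | Adj' v w}.ncard) (hS' : ∀ i, ℓ' i ∈ S')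
    (heq : clusterFamily S par ℓ = clusterFamily S' par' ℓ') :
    ∃ φ : S ≃ S', (∀ a b : S, Adj' (φ a) (φ b) ↔ Adj a b) ∧
      ∀ i, (φ ⟨ℓ i, hS i⟩ : V') = ℓ' i := by
  have hb := h.bijOn_cluster hred
  have hb' := h'.bijOn_cluster hred'
  rw [← heq] at hb'
  let φ : S ≃ S' := (hb.equiv _).trans (hb'.equiv _).symm
  have hφ : ∀ a : S, cluster par' ℓ' (φ a) = cluster par ℓ a := by
    intro a
    exact congrArg Subtype.val ((hb'.equiv _).apply_symm_apply (hb.equiv _ a))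
  have key : ∀ a b : S, ((φ a : V') ≠ φ b ∧ par' (φ a) = φ b) ↔ ((a : V) ≠ b ∧ par a = b) := by
    intro a b
    rw [h'.adj_iff_cluster hred' (φ a).2 (φ b).2, h.adj_iff_cluster hred a.2 b.2, hφ, hφ, heq]
  refine ⟨φ, fun a b => ?_, fun i => ?_⟩
  · have h1 := key a b
    have h2 := key b a
    rw [h'.adj_iff, h.adj_iff]
    simp only [Subtype.coe_prop, true_and]
    rw [ne_comm] at h2
    rw [ne_comm (a := (b : V))] at h2
    tauto
  · rw [h'.cluster_label_eq hred' hS' (φ _).2, hφ, ← heq]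
    exact (h.cluster_label_eq hred hS (hS i) i).mp rfl

end IsRooted

/-! ### Pruning -/

/-- Redirecting the children of `x` to the parent of `x` does not change the ancestor relation
between vertices other than `x`. -/
theorem isAncestor_skip_iff {V : Type} [DecidableEq V] {par : V → V} {x : V} (hx : par x ≠ x)
    {v w : V} (hv : v ≠ x) (hw : w ≠ x) :
    IsAncestor (fun u => if par u = x then par x else par u) v w ↔ IsAncestor par v w := by
  constructor
  · rintro ⟨k, hk⟩
    induction k generalizing w with
    | zero => exact ⟨0, hk⟩
    | succ k ih =>
      rw [Function.iterate_succ_apply] at hk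
      by_cases h : par w = x
      · rw [if_pos h] at hk
        have h1 := ih hx hk
        rw [← h] at h1
        exact (h1.trans (IsAncestor.parent _)).trans (IsAncestor.parent _)
      · rw [if_neg h] at hk
        exact (ih h hk).trans (IsAncestor.parent _)
  · rintro ⟨k, hk⟩
    induction k using Nat.strong_induction_on generalizing w with
    | _ k ih =>
      rcases k with _ | k
      · exact ⟨0, hk⟩
      · rw [Function.iterate_succ_apply] at hk
        by_cases h : par w = x
        · rcases k with _ | k
          · exact absurd (hk.symm.trans h) hv
          · rw [h, Function.iterate_succ_apply] at hk
            refine (ih k (by omega) hx hk).trans ⟨1, ?_⟩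
            simp [h]
        · refine (ih k (by omega) h hk).trans ⟨1, ?_⟩
          simp [h]

namespace IsRooted

variable {V : Type} {H : PartialGraph V} {r : V} {par : V → V} {x : V}

theorem deleteLeaf (h : IsRooted H.verts H.Adj r par) (hx : x ∈ H.verts) (hxr : x ≠ r)
    (hdeg : (H.neighborSet x).ncard = 1) :
    (∀ c ∈ H.verts, par c ≠ x) ∧
      IsRooted (H.deleteVerts {x}).verts (H.deleteVerts {x}).Adj r par := by
  have hchild : ∀ c ∈ H.verts, par c ≠ x := by
    rintro c hc rfl
    obtain ⟨y, hy⟩ := Set.ncard_eq_one.mp hdeg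
    have hcx : c ≠ par c := by
      intro h1
      rw [← h1] at hxr
      exact h.par_ne hc hxr h1.symm
    have h1 : c ∈ H.neighborSet (par c) := (h.adj_iff _ _).mpr ⟨hx, hc, hcx.symm, Or.inr rfl⟩
    have h2 : par (par c) ∈ H.neighborSet (par c) := h.adj_par hx hxr
    rw [hy] at h1 h2
    refine h.par_par_ne hc ?_ (h2.trans h1.symm)
    rintro rfl
    exact hcx h.par_root.symm
  refine ⟨hchild, ⟨?_, ?_, h.par_root, ?_, ?_⟩⟩
  · simpa using ⟨h.root_mem, hxr.symm⟩
  · intro v hv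
    have hv : v ∈ H.verts ∧ v ≠ x := by simpa using hv
    simpa using ⟨h.par_mem v hv.1, hchild v hv.1⟩
  · intro v hv
    exact h.reach v (by simp at hv; exact hv.1)
  · intro a b
    rw [SimpleGraph.Subgraph.deleteVerts_adj, h.adj_iff]
    simp
    tauto

theorem smooth [DecidableEq V] (h : IsRooted H.verts H.Adj r par) (hx : x ∈ H.verts) (hxr : x ≠ r)
    (hdeg : (H.neighborSet x).ncard = 2) :
    (∃ c ∈ H.verts, c ≠ x ∧ ∀ w ∈ H.verts, w ≠ x → (par w = x ↔ w = c)) ∧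
      IsRooted (H.smooth x).verts (H.smooth x).Adj r
        (fun u => if par u = x then par x else par u) := by
  have hpx := h.par_ne hx hxr
  have hpmem : par x ∈ H.neighborSet x := h.adj_par hx hxr
  obtain ⟨c, hc⟩ : ∃ c, H.neighborSet x = {par x, c} ∧ c ≠ par x := by
    obtain ⟨p, q, hpq, heq⟩ := Set.ncard_eq_two.mp hdeg
    rw [heq] at hpmem
    rcases hpmem with h1 | h1
    · exact ⟨q, by rw [heq, h1], by rw [h1]; exact hpq.symm⟩
    · exact ⟨p, by rw [heq, h1, Set.pair_comm], by rw [h1]; exact hpq⟩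
  obtain ⟨hnb, hcp⟩ := hc
  have hcmem : c ∈ H.neighborSet x := by rw [hnb]; simp
  obtain ⟨-, hcH, hxc, hc⟩ := (h.adj_iff _ _).mp hcmem
  replace hc : par c = x := hc.resolve_left fun h1 => hcp h1.symm
  have hppx : par (par x) ≠ x := h.par_par_ne hx hxr
  have hchild : ∀ w ∈ H.verts, w ≠ x → (par w = x ↔ w = c) := by
    intro w hw hwx
    constructor
    · intro h1
      have h2 : w ∈ H.neighborSet x := (h.adj_iff _ _).mpr ⟨hx, hw, hwx.symm, Or.inr h1⟩
      rw [hnb] at h2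
      rcases h2 with h2 | h2
      · rw [h2] at h1
        exact absurd h1 hppx
      · exact h2
    · rintro rfl
      exact hc
  have hverts : ∀ v, v ∈ (H.smooth x).verts ↔ v ∈ H.verts ∧ v ≠ x := fun v => Iff.rfl
  have hrx : r ≠ x := hxr.symm
  refine ⟨⟨c, hcH, hxc.symm, hchild⟩, ⟨?_, ?_, ?_, ?_, ?_⟩⟩
  · exact (hverts r).mpr ⟨h.root_mem, hrx⟩
  · intro v hv
    obtain ⟨hv, hvx⟩ := (hverts v).mp hv
    rw [hverts]
    split_ifs with h1
    · exact ⟨h.par_mem x hx, hpx⟩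
    · exact ⟨h.par_mem v hv, h1⟩
  · simp [h.par_root, hrx]
  · intro v hv
    obtain ⟨hv, hvx⟩ := (hverts v).mp hv
    exact (isAncestor_skip_iff hpx hrx hvx).mpr (h.reach v hv)
  · intro a b
    have hadj : (H.smooth x).Adj a b ↔
        (a ≠ x ∧ b ≠ x ∧ H.Adj a b) ∨ (a ≠ b ∧ H.Adj a x ∧ H.Adj x b) := Iff.rfl
    rw [hadj, hverts, hverts]
    constructor
    · rintro (⟨hax, hbx, hab⟩ | ⟨hab, hax, hxb⟩)
      · obtain ⟨ha, hb, hne, h1⟩ := (h.adj_iff _ _).mp hab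
        refine ⟨⟨ha, hax⟩, ⟨hb, hbx⟩, hne, ?_⟩
        rcases h1 with h1 | h1
        · left; rw [if_neg (h1 ▸ hbx), h1]
        · right; rw [if_neg (h1 ▸ hax), h1]
      · have ha' : a ∈ H.neighborSet x := hax.symm
        have hb' : b ∈ H.neighborSet x := hxb
        have ha1 := ((h.adj_iff _ _).mp hax).1
        have hb1 := ((h.adj_iff _ _).mp hxb).2.1
        have hax1 : a ≠ x := ((h.adj_iff _ _).mp hax).2.2.1
        have hxb1 : b ≠ x := ((h.adj_iff _ _).mp hxb).2.2.1.symm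
        rw [hnb] at ha' hb'
        refine ⟨⟨ha1, hax1⟩, ⟨hb1, hxb1⟩, hab, ?_⟩
        rcases ha' with rfl | rfl
        · rcases hb' with rfl | rfl
          · exact absurd rfl hab
          · right; rw [if_pos hc]
        · rcases hb' with rfl | rfl
          · left; rw [if_pos hc]
          · exact absurd rfl hab
    · have key : ∀ a b, a ∈ H.verts → a ≠ x → b ∈ H.verts → b ≠ x → a ≠ b →
          (if par a = x then par x else par a) = b →
          (a ≠ x ∧ b ≠ x ∧ H.Adj a b) ∨ (a ≠ b ∧ H.Adj a x ∧ H.Adj x b) := by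
        intro a b ha hax hb hbx hab h1
        split_ifs at h1 with h2
        · right
          exact ⟨hab, (h.adj_iff _ _).mpr ⟨ha, hx, hax, Or.inl h2⟩,
            (h.adj_iff _ _).mpr ⟨hx, hb, hbx.symm, Or.inl h1⟩⟩
        · left
          exact ⟨hax, hbx, (h.adj_iff _ _).mpr ⟨ha, hb, hab, Or.inl h1⟩⟩
      rintro ⟨⟨ha, hax⟩, ⟨hb, hbx⟩, hab, h1 | h1⟩
      · exact key a b ha hax hb hbx hab h1
      · rcases key b a hb hbx ha hax hab.symm h1 with ⟨h2, h3, h4⟩ | ⟨h2, h3, h4⟩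
        · exact Or.inl ⟨h3, h2, h4.symm⟩
        · exact Or.inr ⟨h2.symm, h4.symm, h3.symm⟩

variable {n : ℕ} {ℓ : Fin n → V} {hn : 0 < n}

/-- A pruning step leads from a rooted tree to a rooted tree with the same clusters: a deleted leaf
has an empty cluster, and a smoothed vertex has the same cluster as its child. -/
theorem pruneStep (h : IsRooted H.verts H.Adj (ℓ ⟨0, hn⟩) par) (hℓ : ∀ i, ℓ i ∈ H.verts)
    {H' : PartialGraph V} (hstep : PruneStep (Set.range ℓ) H H') :
    (∀ i, ℓ i ∈ H'.verts) ∧ ∃ par', IsRooted H'.verts H'.Adj (ℓ ⟨0, hn⟩) par' ∧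
      clusterFamily H'.verts par' ℓ = clusterFamily H.verts par ℓ := by
  classical
  cases hstep with
  | deleteLeaf x hx hL hdeg =>
    have hℓx : ∀ i, ℓ i ≠ x := fun i h1 => hL ⟨i, h1⟩
    obtain ⟨hchild, h'⟩ := h.deleteLeaf hx (hℓx _).symm hdeg
    have hverts : ∀ v, v ∈ (H.deleteVerts {x}).verts ↔ v ∈ H.verts ∧ v ≠ x := by simp
    refine ⟨fun i => (hverts _).mpr ⟨hℓ i, hℓx i⟩, par, h', ?_⟩
    ext A
    simp only [mem_clusterFamily, hverts]
    refine and_congr_right fun hA => ⟨?_, ?_⟩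
    · rintro ⟨v, ⟨hv, -⟩, rfl⟩
      exact ⟨v, hv, rfl⟩
    · rintro ⟨v, hv, rfl⟩
      refine ⟨v, ⟨hv, ?_⟩, rfl⟩
      rintro rfl
      obtain ⟨i, hi⟩ := hA
      obtain ⟨_, h1⟩ := mem_cluster.mp hi
      obtain ⟨c, hc, -, hci⟩ := h1.exists_child (hℓx _).symm
      exact hchild c (h.mem_of_isAncestor (hℓ _) hci) hc
  | smooth x hx hL hdeg =>
    have hℓx : ∀ i, ℓ i ≠ x := fun i h1 => hL ⟨i, h1⟩
    have hxr := (hℓx ⟨0, hn⟩).symm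
    obtain ⟨⟨c, hcH, hcx, hc⟩, h'⟩ := h.smooth hx hxr hdeg
    have hverts : ∀ v, v ∈ (H.smooth x).verts ↔ v ∈ H.verts ∧ v ≠ x := fun v => Iff.rfl
    refine ⟨fun i => (hverts _).mpr ⟨hℓ i, hℓx i⟩, _, h', ?_⟩
    have hcl : ∀ v, v ≠ x →
        cluster (fun u => if par u = x then par x else par u) ℓ v = cluster par ℓ v := by
      intro v hv
      ext i
      simp only [mem_cluster]
      exact exists_congr fun hi => isAncestor_skip_iff (h.par_ne hx hxr) hv (hℓx _)
    have hclx : cluster par ℓ c = cluster par ℓ x := by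
      refine (cluster_mono ⟨1, (hc c hcH hcx).mpr rfl⟩).antisymm fun i hi => ?_
      obtain ⟨hin, h1⟩ := mem_cluster.mp hi
      obtain ⟨d, hd, hdx, hdi⟩ := h1.exists_child (hℓx _).symm
      rw [hc d (h.mem_of_isAncestor (hℓ _) hdi) hdx] at hd
      exact mem_cluster.mpr ⟨hin, hd ▸ hdi⟩
    ext A
    simp only [mem_clusterFamily, hverts]
    refine and_congr_right fun hA => ⟨?_, ?_⟩
    · rintro ⟨v, ⟨hv, hvx⟩, rfl⟩
      exact ⟨v, hv, (hcl v hvx).symm⟩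
    · rintro ⟨v, hv, rfl⟩
      by_cases hvx : v = x
      · exact ⟨c, ⟨hcH, hcx⟩, by rw [hcl c hcx, hclx, hvx]⟩
      · exact ⟨v, ⟨hv, hvx⟩, hcl v hvx⟩

theorem pruneSteps (h : IsRooted H.verts H.Adj (ℓ ⟨0, hn⟩) par) (hℓ : ∀ i, ℓ i ∈ H.verts)
    {H' : PartialGraph V} (hsteps : Relation.ReflTransGen (PruneStep (Set.range ℓ)) H H') :
    (∀ i, ℓ i ∈ H'.verts) ∧ ∃ par', IsRooted H'.verts H'.Adj (ℓ ⟨0, hn⟩) par' ∧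
      clusterFamily H'.verts par' ℓ = clusterFamily H.verts par ℓ := by
  induction hsteps with
  | refl => exact ⟨hℓ, par, h, rfl⟩
  | tail _ hstep ih =>
    obtain ⟨hℓ', par', h', heq⟩ := ih
    obtain ⟨hℓ'', par'', h'', heq'⟩ := h'.pruneStep hℓ' hstep
    exact ⟨hℓ'', par'', h'', heq'.trans heq⟩

/-- Pruning can be continued until a Greg tree is reached. -/
theorem exists_pruned [Finite V] (h : IsRooted H.verts H.Adj (ℓ ⟨0, hn⟩) par)
    (hℓ : ∀ i, ℓ i ∈ H.verts) :
    ∃ H', Relation.ReflTransGen (PruneStep (Set.range ℓ)) H H' ∧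
      ∀ v ∈ H'.verts, v ∉ Set.range ℓ → 3 ≤ (H'.neighborSet v).ncard := by
  induction hm : H.verts.ncard using Nat.strong_induction_on generalizing H par with
  | _ m ih =>
    by_cases hred : ∀ v ∈ H.verts, v ∉ Set.range ℓ → 3 ≤ (H.neighborSet v).ncard
    · exact ⟨H, .refl, hred⟩
    · push Not at hred
      obtain ⟨x, hx, hxl, hlt⟩ := hred
      have hxr : x ≠ ℓ ⟨0, hn⟩ := fun h1 => hxl ⟨_, h1.symm⟩
      have hpos : 0 < (H.neighborSet x).ncard :=
        (Set.ncard_pos (Set.toFinite _)).mpr ⟨_, h.adj_par hx hxr⟩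
      obtain ⟨H', hstep, hverts⟩ : ∃ H', PruneStep (Set.range ℓ) H H' ∧ H'.verts = H.verts \ {x} := by
        obtain h1 | h2 : (H.neighborSet x).ncard = 1 ∨ (H.neighborSet x).ncard = 2 := by omega
        · exact ⟨_, .deleteLeaf H x hx hxl h1, by simp⟩
        · exact ⟨_, .smooth H x hx hxl h2, rfl⟩
      obtain ⟨hℓ', par', h', -⟩ := h.pruneStep hℓ hstep
      have hlt' : H'.verts.ncard < m := by
        rw [hverts, ← hm]
        exact Set.ncard_sdiff_singleton_lt_of_mem hx
      obtain ⟨H'', hsteps, hred'⟩ := ih _ hlt' h' hℓ' rfl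
      exact ⟨H'', .head hstep hsteps, hred'⟩

end IsRooted

/-! ### Parent functions of trees -/

/-- Every tree can be rooted at any vertex: the parent of `v` is the penultimate vertex of the path
from the root to `v`. -/
theorem SimpleGraph.IsTree.exists_isRooted {V : Type} {G : SimpleGraph V} (hG : G.IsTree) (r : V) :
    ∃ par, IsRooted Set.univ G.Adj r par := by
  choose p hp using fun v => hG.connected.exists_walk_length_eq_dist r v
  have hpath : ∀ v, (p v).IsPath := fun v => (p v).isPath_of_length_eq_dist (hp v)
  have hpar : ∀ a b, G.Adj a b → G.dist r a = G.dist r b + 1 → (p a).penultimate = b := by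
    intro a b hab hd
    have h1 : ((p b).concat hab.symm).IsPath :=
      SimpleGraph.Walk.isPath_of_length_eq_dist _ (by rw [SimpleGraph.Walk.length_concat, hp, hd])
    have h2 : p a = (p b).concat hab.symm :=
      (hG.existsUnique_path r a).unique (hpath a) h1
    rw [h2, SimpleGraph.Walk.penultimate_concat]
  have hnil : ∀ v, v ≠ r → ¬ (p v).Nil := fun v hv h1 => hv h1.eq.symm
  have hroot : (p r).penultimate = r := by
    have h1 : p r = .nil := (hG.existsUnique_path r r).unique (hpath r) .nil
    rw [h1]
    rfl
  refine ⟨fun v => (p v).penultimate, ⟨trivial, fun _ _ => trivial, hroot, ?_, ?_⟩⟩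
  · intro v _
    induction hm : G.dist r v using Nat.strong_induction_on generalizing v with
    | _ m ih =>
      by_cases hv : v = r
      · exact ⟨0, hv⟩
      · have h1 : G.dist r (p v).penultimate < m := by
          have h2 := SimpleGraph.dist_le (p v).dropLast
          have h3 := SimpleGraph.Walk.length_dropLast_add_one (hnil v hv)
          have h4 := hp v
          omega
        obtain ⟨k, hk⟩ := ih _ h1 _ trivial rfl
        exact ⟨k + 1, hk⟩
  · intro a b
    constructor
    · intro hab
      refine ⟨trivial, trivial, hab.ne, ?_⟩
      rcases hG.dist_eq_dist_add_one_of_adj r hab with h1 | h1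
      · exact Or.inl (hpar a b hab h1)
      · exact Or.inr (hpar b a hab.symm h1)
    · have key : ∀ a b, a ≠ b → (p a).penultimate = b → G.Adj a b := by
        rintro a b hab rfl
        refine ((p a).adj_penultimate (hnil a ?_)).symm
        rintro rfl
        exact hab hroot.symm
      rintro ⟨-, -, hab, h1 | h1⟩
      · exact key a b hab h1
      · exact (key b a hab.symm h1).symm

theorem IsRooted.isTree {V : Type} [Finite V] {G : SimpleGraph V} {r : V} {par : V → V}
    (h : IsRooted Set.univ G.Adj r par) : G.IsTree := by
  have hconn : G.Connected := by
    have hr : ∀ v, G.Reachable v r := by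
      intro v
      obtain ⟨k, hk⟩ := h.reach v trivial
      induction k generalizing v with
      | zero => exact hk ▸ .refl _
      | succ k ih =>
        by_cases hv : v = r
        · exact hv ▸ .refl _
        · exact (h.adj_par trivial hv).reachable.trans (ih _ hk)
    have : Nonempty V := ⟨r⟩
    exact ⟨fun v w => (hr v).trans (hr w).symm⟩
  refine SimpleGraph.isTree_iff_connected_and_card.mpr ⟨hconn, ?_⟩
  -- Every edge joins a vertex other than the root to its parent.
  have hsub : G.edgeSet ⊆ (fun v => s(v, par v)) '' {r}ᶜ := by
    intro e
    induction e with
    | _ a b =>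
      intro he
      have key : ∀ a b, a ≠ b → par a = b → s(a, b) ∈ (fun v => s(v, par v)) '' {r}ᶜ := by
        rintro a b hab rfl
        refine ⟨a, ?_, rfl⟩
        rintro rfl
        exact hab h.par_root.symm
      obtain ⟨-, -, hab, h1 | h1⟩ := (h.adj_iff a b).mp he
      · exact key a b hab h1
      · rw [Sym2.eq_swap]
        exact key b a hab.symm h1
  have h1 := (Set.ncard_le_ncard hsub (Set.toFinite _)).trans (Set.ncard_image_le (Set.toFinite _))
  have h2 := hconn.card_vert_le_card_edgeSet_add_one
  have h3 := Set.ncard_add_ncard_compl ({r} : Set V)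
  rw [Set.ncard_singleton] at h3
  rw [Nat.card_coe_set_eq] at h2 ⊢
  omega

/-! ### Cayley trees and families of clusters -/

/-- Every family of `m` clusters on `m` labels is the family of a Cayley tree: each vertex is
identified with the least cluster containing it, and its parent is the next larger cluster. -/
theorem IsGregFamily.exists_cayleyTree {m : ℕ} {F : Finset (Finset ℕ)} (h : IsGregFamily m F)
    (hcard : F.card = m) :
    ∃ (X : CayleyTree m) (par : Fin m → Fin m),
      IsRooted Set.univ X.1.Adj ⟨0, h.pos⟩ par ∧ clusterFamily Set.univ par id = F := by
  classical
  have hm := h.pos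
  have hlab : ∀ A ∈ F, IsLabeledCluster F A := by
    have h1 : F.filter (IsLabeledCluster F) = F :=
      Finset.eq_of_subset_of_card_le (Finset.filter_subset _ _) (by rw [h.card_labeled, hcard])
    intro A hA
    rw [← h1] at hA
    exact (Finset.mem_filter.mp hA).2
  choose cl hclF hclmem hclmin using fun i : Fin m => h.exists_least i.isLt
  have hclinj : Function.Injective cl := by
    intro i j hij
    by_contra hne
    obtain ⟨A, hA, hAij⟩ := h.sep i i.isLt j j.isLt (by simpa [Fin.ext_iff] using hne)
    exact hAij ⟨fun hi => hclmin i A hA hi (hij ▸ hclmem j),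
      fun hj => hclmin j A hA hj (hij ▸ hclmem i)⟩
  have hclsurj : ∀ A ∈ F, ∃ i, cl i = A := by
    intro A hA
    obtain ⟨i, hi, hmin⟩ := hlab A hA
    have him : i < m := by simpa using h.subset A hA hi
    exact ⟨⟨i, him⟩, (hclmin ⟨i, him⟩ A hA hi).antisymm (hmin _ (hclF _) (hclmem ⟨i, him⟩))⟩
  set r : Fin m := ⟨0, hm⟩ with hr
  have hclr : cl r = Finset.range m := h.root _ (hclF r) (hclmem r)
  have hnext : ∀ i, i ≠ r → ∃ j, cl i ⊂ cl j ∧ ∀ B ∈ F, cl i ⊂ B → cl j ⊆ B := by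
    intro i hi
    have hss : cl i ⊂ Finset.range m := by
      refine (h.subset _ (hclF i)).ssubset_of_ne fun h1 => hi (hclinj (h1.trans hclr.symm))
    obtain ⟨B, hB, hmin⟩ := Finset.exists_min_image (F.filter (cl i ⊂ ·)) Finset.card
      ⟨_, Finset.mem_filter.mpr ⟨h.univ_mem, hss⟩⟩
    obtain ⟨hBF, hiB⟩ := Finset.mem_filter.mp hB
    obtain ⟨j, rfl⟩ := hclsurj B hBF
    refine ⟨j, hiB, fun C hC hiC => ?_⟩
    rcases h.laminar _ hBF C hC with h1 | h1 | h1
    · exact h1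
    · rw [Finset.eq_of_subset_of_card_le h1 (hmin C (Finset.mem_filter.mpr ⟨hC, hiC⟩))]
    · exact absurd (hiC.subset (hclmem i)) (Finset.disjoint_left.mp h1 (hiB.subset (hclmem i)))
  choose! next hnext_lt hnext_min using hnext
  let par : Fin m → Fin m := fun i => if i = r then r else next i
  have hpar : ∀ i, i ≠ r → par i = next i := fun i hi => if_neg hi
  have hpar_sub : ∀ i, cl i ⊆ cl (par i) := by
    intro i
    by_cases hi : i = r
    · simp [par, hi]
    · rw [hpar i hi]
      exact (hnext_lt i hi).subset
  have hanc : ∀ v w, IsAncestor par v w ↔ cl w ⊆ cl v := by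
    intro v w
    constructor
    · rintro ⟨k, rfl⟩
      induction k generalizing w with
      | zero => exact subset_rfl
      | succ k ih => exact (hpar_sub w).trans (ih (par w))
    · intro hsub
      induction hd : (cl v).card - (cl w).card using Nat.strong_induction_on generalizing w with
      | _ d ih =>
        by_cases hvw : v = w
        · exact hvw ▸ IsAncestor.refl _
        · have hss : cl w ⊂ cl v := hsub.ssubset_of_ne fun h1 => hvw (hclinj h1.symm)
          have hwr : w ≠ r := by
            rintro rfl
            rw [hclr] at hss
            exact hss.not_subset (h.subset _ (hclF v))
          have h1 := hnext_min w hwr _ (hclF v) hss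
          have h2 := Finset.card_lt_card (hnext_lt w hwr)
          have h3 := Finset.card_le_card h1
          rw [← hpar w hwr] at h1 h2 h3
          exact (ih _ (by omega) (par w) h1 rfl).trans (IsAncestor.parent w)
  let G : SimpleGraph (Fin m) := SimpleGraph.fromRel fun a b => par a = b
  have hroot : IsRooted Set.univ G.Adj r par := by
    refine ⟨trivial, fun _ _ => trivial, if_pos rfl, fun v _ => ?_, fun a b => ?_⟩
    · refine (hanc r v).mpr ?_
      rw [hclr]
      exact h.subset _ (hclF v)
    · simp [G, SimpleGraph.fromRel_adj]
  refine ⟨⟨G, hroot.isTree⟩, par, hroot, ?_⟩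
  have hcluster : ∀ v, cluster par id v = cl v := by
    intro v
    ext i
    rw [mem_cluster]
    constructor
    · rintro ⟨hi, h1⟩
      exact (hanc _ _).mp h1 (hclmem ⟨i, hi⟩)
    · intro hi
      have him : i < m := by simpa using h.subset _ (hclF v) hi
      exact ⟨him, (hanc _ _).mpr (hclmin ⟨i, him⟩ _ (hclF v) hi)⟩
  ext A
  rw [mem_clusterFamily]
  constructor
  · rintro ⟨-, v, -, rfl⟩
    exact hcluster v ▸ hclF v
  · intro hA
    obtain ⟨v, rfl⟩ := hclsurj A hA
    exact ⟨h.nonempty _ hA, v, trivial, hcluster v⟩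

/-- There is no Greg tree of size `0`, since a finite tree has a vertex of degree at most `1`. -/
theorem GregTree.pos {n : ℕ} (T : GregTree n) : 0 < n := by
  classical
  rcases Nat.eq_zero_or_pos n with rfl | hn
  swap
  · exact hn
  exfalso
  have := T.finite
  have := Fintype.ofFinite T.V
  have hdeg : ∀ v, 3 ≤ T.graph.degree v := by
    intro v
    have h1 := T.three_le_degree v (by simp)
    rwa [← Nat.card_coe_set_eq, Nat.card_eq_fintype_card, SimpleGraph.card_neighborSet_eq_degree] at h1
  have hV := T.isTree.connected.nonempty
  rcases subsingleton_or_nontrivial T.V with hs | hs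
  · obtain ⟨v⟩ := hV
    have h1 := hdeg v
    rw [SimpleGraph.degree_eq_zero_of_subsingleton] at h1
    omega
  · obtain ⟨v, hv⟩ := T.isTree.exists_vert_degree_one_of_nontrivial
    have h1 := hdeg v
    omega

theorem GregTree.card_clusterFamily {n : ℕ} (T : GregTree n) {par : T.V → T.V}
    (h : IsRooted Set.univ T.graph.Adj (T.label ⟨0, T.pos⟩) par) :
    (clusterFamily Set.univ par T.label).card = n + T.unl := by
  have := T.finite
  rw [h.card_clusterFamily fun v _ hv => T.three_le_degree v hv, GregTree.unl,
    Set.ncard_univ, ← Set.ncard_add_ncard_compl (Set.range T.label), ← Nat.card_coe_set_eq,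
    Nat.card_range_of_injective T.label.injective, Nat.card_fin]

/-- Restricting a Cayley tree to the first `n` labels yields the Greg tree `T` if and only if the
first `n` labels have the same clusters in both trees. -/
theorem CayleyTree.restrictsTo_iff {n k : ℕ} (X : CayleyTree (n + k)) (T : GregTree n)
    {par : Fin (n + k) → Fin (n + k)} {parT : T.V → T.V}
    (h : IsRooted Set.univ X.1.Adj (Fin.castAdd k ⟨0, T.pos⟩) par)
    (hT : IsRooted Set.univ T.graph.Adj (T.label ⟨0, T.pos⟩) parT) :
    X.RestrictsTo T ↔
      clusterFamily Set.univ par (Fin.castAdd k) = clusterFamily Set.univ parT T.label := by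
  have := T.finite
  set H₀ : PartialGraph (Fin (n + k)) := SimpleGraph.toSubgraph X.1 le_top
  have h₀ : IsRooted H₀.verts H₀.Adj (Fin.castAdd k ⟨0, T.pos⟩) par := h
  have hredT : ∀ v ∈ Set.univ, v ∉ Set.range T.label → 3 ≤ {w | T.graph.Adj v w}.ncard :=
    fun v _ hv => T.three_le_degree v hv
  constructor
  · rintro ⟨H, hsteps, φ, hφ⟩
    obtain ⟨hℓ, par', h', heq⟩ := h₀.pruneSteps (ℓ := Fin.castAdd k) (fun _ => trivial) hsteps
    -- The parent function of `H`, transported to `T` along the isomorphism.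
    let par'' : T.V → T.V := fun v => φ.symm ⟨par' (φ v), h'.par_mem _ (φ v).2⟩
    have hiter : ∀ j v, (φ (par''^[j] v) : Fin (n + k)) = par'^[j] (φ v) := by
      intro j v
      induction j generalizing v with
      | zero => rfl
      | succ j ih => rw [Function.iterate_succ_apply, Function.iterate_succ_apply, ih]; simp [par'']
    have hone : ∀ v, (φ (par'' v) : Fin (n + k)) = par' (φ v) := hiter 1
    have hinj : ∀ {v w}, (φ v : Fin (n + k)) = φ w ↔ v = w := by
      intro v w
      rw [Subtype.val_inj, φ.injective.eq_iff]
    have h'' : IsRooted Set.univ T.graph.Adj (T.label ⟨0, T.pos⟩) par'' := by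
      refine ⟨trivial, fun _ _ => trivial, ?_, fun v _ => ?_, fun a b => ?_⟩
      · rw [← hinj, hone, hφ, h'.par_root]
      · obtain ⟨j, hj⟩ := h'.reach _ (φ v).2
        exact ⟨j, by rw [← hinj, hiter, hφ, hj]⟩
      · rw [← φ.map_rel_iff, SimpleGraph.Subgraph.coe_adj, h'.adj_iff, ← hone, ← hone, hinj, hinj,
          ne_eq, hinj]
        simp
    have hanc : ∀ v w, IsAncestor par'' v w ↔ IsAncestor par' (φ v) (φ w) := by
      intro v w
      refine exists_congr fun j => ?_
      rw [← hiter, hinj]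
    have hcl : ∀ v, cluster par' (Fin.castAdd k) (φ v : Fin (n + k)) = cluster par'' T.label v := by
      intro v
      ext i
      simp only [mem_cluster]
      refine exists_congr fun hi => ?_
      rw [hanc, hφ]
    have h1 : clusterFamily Set.univ parT T.label = clusterFamily Set.univ par'' T.label := by
      have h2 : parT = par'' := funext fun v => h''.par_unique hT trivial
      rw [h2]
    rw [h1]
    refine heq.symm.trans ?_
    ext A
    simp only [mem_clusterFamily]
    refine and_congr_right fun _ => ⟨?_, ?_⟩
    · rintro ⟨v, hv, rfl⟩
      exact ⟨φ.symm ⟨v, hv⟩, trivial, by rw [← hcl]; simp⟩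
    · rintro ⟨v, -, rfl⟩
      exact ⟨φ v, (φ v).2, hcl v⟩
  · intro heq
    obtain ⟨H, hsteps, hred⟩ := h₀.exists_pruned (ℓ := Fin.castAdd k) fun _ => trivial
    obtain ⟨hℓ, par', h', heq'⟩ := h₀.pruneSteps (ℓ := Fin.castAdd k) (fun _ => trivial) hsteps
    obtain ⟨φ, hadj, hφ⟩ := hT.exists_equiv hredT (fun _ => trivial) h' hred hℓ
      (heq.symm.trans heq'.symm)
    refine ⟨H, hsteps, ⟨(Equiv.Set.univ T.V).symm.trans φ, ?_⟩, fun i => hφ i⟩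
    intro a b
    exact hadj ⟨a, trivial⟩ ⟨b, trivial⟩

/-- Sending a Cayley tree to its family of clusters is a bijection from the Cayley trees that
restrict to `T` to the families counted by `cayleyFamilyCount`. -/
theorem ncard_restrictsTo {n : ℕ} (T : GregTree n) (k : ℕ) {parT : T.V → T.V}
    (hT : IsRooted Set.univ T.graph.Adj (T.label ⟨0, T.pos⟩) parT) :
    {X : CayleyTree (n + k) | X.RestrictsTo T}.ncard =
      cayleyFamilyCount n k (clusterFamily Set.univ parT T.label) := by
  classical
  have hpos : 0 < n + k := Nat.add_pos_left T.pos k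
  choose par hpar using fun X : CayleyTree (n + k) =>
    X.2.exists_isRooted (id (⟨0, hpos⟩ : Fin (n + k)))
  have hred : ∀ X : CayleyTree (n + k), ∀ v ∈ Set.univ, v ∉ Set.range (id : Fin (n + k) → _) →
      3 ≤ {w | X.1.Adj v w}.ncard := by simp
  have hrestr : ∀ X : CayleyTree (n + k), X.RestrictsTo T ↔
      familyTrace n (clusterFamily Set.univ (par X) id) = clusterFamily Set.univ parT T.label := by
    intro X
    rw [X.restrictsTo_iff T (hpar X) hT, familyTrace_clusterFamily, Function.id_comp]
  have hbij : Set.BijOn (fun X => clusterFamily Set.univ (par X) id)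
      {X : CayleyTree (n + k) | X.RestrictsTo T}
      ((gregFamilies (n + k)).filter fun F' => F'.card = n + k ∧
        familyTrace n F' = clusterFamily Set.univ parT T.label) := by
    refine ⟨fun X hX => ?_, fun X _ Y _ hXY => ?_, fun F hF => ?_⟩
    · refine Finset.mem_coe.mpr (Finset.mem_filter.mpr ⟨mem_gregFamilies.mpr
        ((hpar X).isGregFamily Function.injective_id fun _ => trivial), ?_, (hrestr X).mp hX⟩)
      rw [(hpar X).card_clusterFamily (hred X)]
      simp
    · obtain ⟨φ, hadj, hφ⟩ := (hpar X).exists_equiv (hred X) (fun _ => trivial) (hpar Y) (hred Y)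
        (fun _ => trivial) hXY
      refine Subtype.ext (SimpleGraph.ext (funext₂ fun a b => propext ?_))
      have h1 := hadj ⟨a, trivial⟩ ⟨b, trivial⟩
      have ha : (φ ⟨a, trivial⟩ : Fin (n + k)) = a := hφ a
      have hb : (φ ⟨b, trivial⟩ : Fin (n + k)) = b := hφ b
      rw [ha, hb] at h1
      exact h1.symm
    · obtain ⟨hF, hcard, htr⟩ := Finset.mem_filter.mp (Finset.mem_coe.mp hF)
      obtain ⟨X, par', h', heq⟩ := (mem_gregFamilies.mp hF).exists_cayleyTree hcard
      have h1 : clusterFamily Set.univ (par X) id = F := by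
        have h2 : par X = par' := funext fun v => h'.par_unique (hpar X) trivial
        rw [h2, heq]
      exact ⟨X, (hrestr X).mpr (by rw [h1, htr]), h1⟩
  rw [cayleyFamilyCount, ← Set.ncard_coe_finset, ← hbij.image_eq, hbij.injOn.ncard_image]

theorem mainTheorem2 (n : ℕ) (T : GregTree n) :
    restrictionSeries T =
      ((PowerSeries.exp ℚ).subst ((n : PowerSeries ℚ) * treeSeries) : PowerSeries ℚ) *
        ((1 - treeSeries) ^ (n - 1))⁻¹ * (treeSeries * (1 - treeSeries)⁻¹) ^ T.unl := by
  have hinv : ((1 - treeSeries) ^ (n - 1))⁻¹ = (1 - treeSeries)⁻¹ ^ (n - 1) := by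
    have h1 : PowerSeries.constantCoeff (1 - treeSeries) ≠ 0 := by
      simp [constantCoeff_treeSeries]
    rw [PowerSeries.inv_eq_iff_mul_eq_one (by simp [constantCoeff_treeSeries]), ← mul_pow,
      PowerSeries.inv_mul_cancel _ h1, one_pow]
  rw [exp_subst_eq_pow, hinv]
  obtain ⟨par, hpar⟩ := T.isTree.exists_isRooted (T.label ⟨0, T.pos⟩)
  have hF := hpar.isGregFamily T.label.injective fun _ => trivial
  ext k
  have h1 := coeff_gregSeries k hF
  rw [T.card_clusterFamily hpar, Nat.add_sub_cancel_left] at h1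
  rw [restrictionSeries, PowerSeries.coeff_mk, ncard_restrictsTo T k hpar, h1, gregSeries]
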